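/- All rings are commutative with $1\neq 0$ and all modules are unital. A proper ideal $I$ of a ring $R$ is an OA-ideal ($1$-absorbing prime ideal) if for all nonunits $a,b,c\in R$ with $abc\in I$ one has $ab\in I$ or $c\in I$. $R$ is an OAF-ring if every proper ideal of $R$ is a finite product of OA-ideals, and a general ZPI-ring if every proper ideal of $R$ is a finite product of prime ideals. An ideal is divided if it is comparable (under inclusion) to every ideal of the ring. A ring is local if it has exactly one maximal ideal. Let $A$ be a ring with Jacobson radical $M$, let $E$ be an $A$-module, and let $R=A\propto E$ be the trivial ring extension, i.e. the additive group $A\oplus E$ with multiplication $(a,e)(b,f)=(ab,af+be)$. (1) $R$ is an OAF-ring if and only if one of the following conditions holds: (A) $A$ is a general ZPI-ring, $E$ is cyclic, and the annihilator of $E$ is a (possibly empty) finite product of idempotent maximal ideals of $A$; (B) $A$ is local, $M^2$ is divided, $E=0$, and either $M$ is nilpotent or $A$ is a domain with $\bigcap_{n\geq 1}M^n=0$; (C) $A$ is local, $M^2=0$, $ME=aE$ for each nonzero $a\in M$, and $ME=Mx$ for each $x\in E\setminus ME$. In particular, if $R$ is an OAF-ring, then $A$ is an OAF-ring. (2) Every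 proper ideal of $R$ is an OA-ideal if and only if $A$ is local, $M^2=0$ and $ME=0$. -/

import Mathlib

open scoped Pointwise

/-- A `1`-absorbing prime ideal (OA-ideal): a proper ideal `I` such that `abc ∈ I` with `a, b, c`
nonunits implies `ab ∈ I` or `c ∈ I`. -/
def IsOAIdeal {R : Type*} [CommRing R] (I : Ideal R) : Prop :=
  I ≠ ⊤ ∧ ∀ a b c : R, ¬ IsUnit a → ¬ IsUnit b → ¬ IsUnit c →
    a * b * c ∈ I → a * b ∈ I ∨ c ∈ I

/-- `I` is a finite product of ideals each of which has the property `p`. The empty product is the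
unit ideal, so a factorization of a proper ideal has at least one factor. -/
def IsProductOf {R : Type*} [CommRing R] (p : Ideal R → Prop) (I : Ideal R) : Prop :=
  ∃ s : Multiset (Ideal R), (∀ J ∈ s, p J) ∧ s.prod = I

/-- A `1`-absorbing prime factorization ring (OAF-ring): every proper ideal is a finite product of
OA-ideals. -/
def IsOAFRing (R : Type*) [CommRing R] : Prop :=
  ∀ I : Ideal R, I ≠ ⊤ → IsProductOf IsOAIdeal I

/-- A general ZPI-ring: every proper ideal is a finite product of prime ideals. -/
def IsGeneralZPIRing (R : Type*) [CommRing R] : Prop :=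
  ∀ I : Ideal R, I ≠ ⊤ → IsProductOf Ideal.IsPrime I

/-- A divided ideal: an ideal comparable to every ideal of the ring. -/
def IsDividedIdeal {R : Type*} [CommRing R] (I : Ideal R) : Prop :=
  ∀ J : Ideal R, I ≤ J ∨ J ≤ I

/-! An OA-ideal that is not prime contains every product of two nonunits. If two nonunits had a unit
sum, such an ideal would contain the square of that unit, so outside local rings OA means prime and
OAF means general ZPI. Since `A ∝ E` is local exactly when `A` is, the proof splits on locality.

In a local ring, `isOAFRing_iff_of_isLocalRing` characterizes OAF: `𝔪²` is divided, and `𝔪` is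
nilpotent or the ring is a domain with `⋂ 𝔪ⁿ = 0`. If `E = 0` this is (B). If `E ≠ 0`, the
square-zero part excludes domains, and dividedness of `𝔪² ∝ 𝔪E` reads off as (C).

In the general ZPI case, every prime of `A ∝ E` contains `0 ∝ E`, so products of primes are
homogeneous. Factoring `0 ∝ F` and `P ∝ PE` shows that `E` is a multiplication module and that `P² =
P` whenever `PE ≠ E`. Such `P` are minimal primes generated by idempotents, hence finite in number,
and local generators of `E` glue along these idempotents. Conversely, the idempotent generating the
annihilator of `E` splits every ideal into two factors that can be treated directly. -/

/-! ### Finite products of ideals -/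

section ProductOf

variable {R S : Type*} [CommRing R] [CommRing S]

theorem IsProductOf.mono {p q : Ideal R → Prop} {I : Ideal R} (h : IsProductOf p I)
    (hpq : ∀ J, p J → q J) : IsProductOf q I := by
  obtain ⟨s, hs, rfl⟩ := h
  exact ⟨s, fun J hJ => hpq J (hs J hJ), rfl⟩

theorem IsProductOf.of_self {p : Ideal R → Prop} {I : Ideal R} (h : p I) : IsProductOf p I :=
  ⟨{I}, by simpa using h, by simp⟩

theorem isProductOf_top (p : Ideal R → Prop) : IsProductOf p (⊤ : Ideal R) :=
  ⟨0, by simp, by simp [Ideal.one_eq_top]⟩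

theorem IsProductOf.mul {p : Ideal R → Prop} {I J : Ideal R} (hI : IsProductOf p I)
    (hJ : IsProductOf p J) : IsProductOf p (I * J) := by
  obtain ⟨s, hs, rfl⟩ := hI
  obtain ⟨t, ht, rfl⟩ := hJ
  refine ⟨s + t, fun J hJ => ?_, by simp⟩
  rcases Multiset.mem_add.1 hJ with h | h
  exacts [hs J h, ht J h]

theorem IsProductOf.pow {p : Ideal R → Prop} {I : Ideal R} (hI : IsProductOf p I) (n : ℕ) :
    IsProductOf p (I ^ n) := by
  induction n with
  | zero => simpa [Ideal.one_eq_top] using isProductOf_top p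
  | succ n ih => rw [pow_succ]; exact ih.mul hI

theorem Ideal.multiset_prod_le_of_mem {s : Multiset (Ideal R)} {J : Ideal R} (hJ : J ∈ s) :
    s.prod ≤ J :=
  Ideal.multiset_prod_le_inf.trans (Multiset.inf_le hJ)

theorem Ideal.map_multiset_prod_eq (f : R →+* S) (s : Multiset (Ideal R)) :
    Ideal.map f s.prod = (s.map (Ideal.map f)).prod :=
  _root_.map_multiset_prod (Ideal.mapHom f) s

/-- The premise `I ≤ J` on factors supplies `ker f ≤ J` when `I` is a preimage. -/
theorem IsProductOf.map {p : Ideal R → Prop} {q : Ideal S → Prop} (f : R →+* S) {I : Ideal R}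
    (h : IsProductOf p I) (hpq : ∀ J, p J → I ≤ J → q (J.map f)) : IsProductOf q (I.map f) := by
  obtain ⟨s, hs, rfl⟩ := h
  refine ⟨s.map (Ideal.map f), fun J hJ => ?_, (Ideal.map_multiset_prod_eq f s).symm⟩
  obtain ⟨K, hK, rfl⟩ := Multiset.mem_map.1 hJ
  exact hpq K (hs K hK) (Ideal.multiset_prod_le_of_mem hK)

theorem Ideal.pow_card_le_multiset_prod {s : Multiset (Ideal R)} {J : Ideal R}
    (h : ∀ K ∈ s, J ≤ K) : J ^ Multiset.card s ≤ s.prod := by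
  induction s using Multiset.induction_on with
  | empty => simp
  | cons K s ih =>
    rw [Multiset.card_cons, Multiset.prod_cons, pow_succ']
    exact Ideal.mul_mono (h K (Multiset.mem_cons_self K s))
      (ih fun L hL => h L (Multiset.mem_cons_of_mem hL))

theorem Ideal.le_pow_of_mul_self_eq {P : Ideal R} (hPP : P * P = P) (n : ℕ) : P ≤ P ^ n := by
  induction n with
  | zero => simp
  | succ n ih =>
    calc P = P * P := hPP.symm
      _ ≤ _ := by rw [pow_succ]; exact Ideal.mul_mono_left ih

end ProductOf

/-! ### OA-ideals and surjective images -/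

section OAIdeal

variable {R S : Type*} [CommRing R] [CommRing S] {I : Ideal R}

theorem Ideal.IsPrime.isOAIdeal (h : I.IsPrime) : IsOAIdeal I :=
  ⟨h.ne_top, fun _ _ _ _ _ _ habc => h.mem_or_mem habc⟩

theorem IsGeneralZPIRing.isOAFRing (h : IsGeneralZPIRing R) : IsOAFRing R :=
  fun I hI => (h I hI).mono fun _ hJ => hJ.isOAIdeal

/-- Take `xy ∈ I` with `x, y ∉ I`. Then `b·x·y ∈ I` forces `bx ∈ I`, and `a·b·x ∈ I` forces `ab ∈
I`. -/
theorem IsOAIdeal.mul_mem_of_not_isPrime (hI : IsOAIdeal I) (h : ¬ I.IsPrime) {a b : R}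
    (ha : ¬ IsUnit a) (hb : ¬ IsUnit b) : a * b ∈ I := by
  rw [Ideal.isPrime_iff] at h
  push Not at h
  obtain ⟨x, y, hxy, hx, hy⟩ := h hI.1
  have hxu : ¬ IsUnit x := fun hu => hy ((Ideal.unit_mul_mem_iff_mem I hu).1 hxy)
  have hyu : ¬ IsUnit y := fun hu => hx ((Ideal.mul_unit_mem_iff_mem I hu).1 hxy)
  have hbx : b * x ∈ I := (hI.2 b x y hb hxu hyu (by
    rw [mul_assoc]; exact I.mul_mem_left b hxy)).resolve_right hy
  exact (hI.2 a b x ha hb hxu (by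
    rw [mul_assoc]; exact I.mul_mem_left a hbx)).resolve_right hx

theorem IsOAIdeal.isPrime_or_isLocalRing [Nontrivial R] (hI : IsOAIdeal I) :
    I.IsPrime ∨ IsLocalRing R := by
  by_contra! h
  obtain ⟨h, hloc⟩ := h
  refine hloc (IsLocalRing.of_nonunits_add fun a b ha hb hab => hI.1 ?_)
  refine I.eq_top_of_isUnit_mem (x := (a + b) * (a + b)) ?_ (hab.mul hab)
  have h1 := hI.mul_mem_of_not_isPrime h ha ha
  have h2 := hI.mul_mem_of_not_isPrime h ha hb
  have h3 := hI.mul_mem_of_not_isPrime h hb hb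
  have : (a + b) * (a + b) = a * a + (a * b + a * b) + b * b := by ring
  rw [this]
  exact I.add_mem (I.add_mem h1 (I.add_mem h2 h2)) h3

theorem IsOAFRing.isGeneralZPIRing_of_not_isLocalRing [Nontrivial R] (h : IsOAFRing R)
    (hloc : ¬ IsLocalRing R) : IsGeneralZPIRing R :=
  fun I hI => (h I hI).mono fun _ hJ => hJ.isPrime_or_isLocalRing.resolve_right hloc

theorem IsGeneralZPIRing.of_surjective (h : IsGeneralZPIRing R) (f : R →+* S)
    (hf : Function.Surjective f) : IsGeneralZPIRing S := by
  intro I hI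
  rw [← Ideal.map_comap_of_surjective f hf I]
  refine (h _ (Ideal.comap_ne_top f hI)).map f fun J hJ hIJ => ?_
  exact Ideal.map_isPrime_of_surjective hf ((Ideal.ker_le_comap f).trans hIJ)

theorem IsOAIdeal.map_of_surjective (hI : IsOAIdeal I) (f : R →+* S) [IsLocalHom f]
    (hf : Function.Surjective f) (hk : RingHom.ker f ≤ I) : IsOAIdeal (I.map f) := by
  have key : ∀ x, f x ∈ I.map f ↔ x ∈ I := fun x => by
    rw [← Ideal.mem_comap, Ideal.comap_map_of_surjective' f hf, sup_eq_left.2 hk]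
  refine ⟨fun h => hI.1 ?_, fun a b c ha hb hc habc => ?_⟩
  · rw [Ideal.eq_top_iff_one, ← key, h]; trivial
  · obtain ⟨a, rfl⟩ := hf a
    obtain ⟨b, rfl⟩ := hf b
    obtain ⟨c, rfl⟩ := hf c
    rw [← map_mul, ← map_mul, key] at habc
    rw [← map_mul, key, key]
    exact hI.2 a b c (fun h => ha (h.map f)) (fun h => hb (h.map f)) (fun h => hc (h.map f)) habc

theorem IsOAFRing.of_surjective (h : IsOAFRing R) (f : R →+* S) [IsLocalHom f]
    (hf : Function.Surjective f) : IsOAFRing S := by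
  intro I hI
  rw [← Ideal.map_comap_of_surjective f hf I]
  refine (h _ (Ideal.comap_ne_top f hI)).map f fun J hJ hIJ => ?_
  exact hJ.map_of_surjective f hf ((Ideal.ker_le_comap f).trans hIJ)

end OAIdeal

/-! ### Local OAF-rings: structure of `𝔪²` -/

section Local

open IsLocalRing

variable {R : Type*} [CommRing R] [IsLocalRing R] {I : Ideal R}

theorem isOAIdeal_of_sq_le (hI : I ≠ ⊤) (h : maximalIdeal R ^ 2 ≤ I) : IsOAIdeal I :=
  ⟨hI, fun a b _ ha hb _ _ => Or.inl (h (by rw [pow_two]; exact Ideal.mul_mem_mul ha hb))⟩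

theorem IsOAIdeal.isPrime_or_sq_le (hI : IsOAIdeal I) :
    I.IsPrime ∨ maximalIdeal R ^ 2 ≤ I := by
  by_cases h : I.IsPrime
  · exact Or.inl h
  · right
    rw [pow_two, Ideal.mul_le]
    exact fun a ha b hb => hI.mul_mem_of_not_isPrime h ha hb

/-- In a local OAF-ring a proper ideal not contained in the square of the maximal ideal is an
OA-ideal. -/
theorem IsOAFRing.isOAIdeal_of_not_le_sq (h : IsOAFRing R) (hI : I ≠ ⊤)
    (hI2 : ¬ I ≤ maximalIdeal R ^ 2) : IsOAIdeal I := by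
  obtain ⟨s, hs, hsI⟩ := h I hI
  induction s using Multiset.induction_on with
  | empty => exact absurd (by simpa using hsI.symm) hI
  | cons J s _ =>
    induction s using Multiset.induction_on with
    | empty =>
      rw [Multiset.prod_cons, Multiset.prod_zero, mul_one] at hsI
      exact hsI ▸ hs J (by simp)
    | cons K s _ =>
      refine absurd ?_ hI2
      rw [← hsI, Multiset.prod_cons, Multiset.prod_cons, ← mul_assoc, pow_two]
      exact Ideal.mul_le_left.trans (Ideal.mul_mono (le_maximalIdeal (hs J (by simp)).1)
        (le_maximalIdeal (hs K (by simp)).1))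

theorem eq_zero_of_mem_maximalIdeal_of_mul_eq {r x : R} (hr : r ∈ maximalIdeal R)
    (h : x = r * x) : x = 0 := by
  have hu : IsUnit (1 - r) := (isUnit_or_isUnit_one_sub_self r).resolve_left hr
  rw [← hu.mul_right_eq_zero]
  linear_combination h

theorem mem_of_mem_sup_span_mul {J : Ideal R} {y r : R} (hr : r ∈ maximalIdeal R)
    (h : y ∈ J ⊔ Ideal.span {r * y}) : y ∈ J := by
  obtain ⟨j, hj, z, hz, rfl⟩ := Submodule.mem_sup.1 h
  obtain ⟨c, hc⟩ := Ideal.mem_span_singleton'.1 hz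
  have hu : IsUnit (1 - c * r) :=
    (isUnit_or_isUnit_one_sub_self (c * r)).resolve_left (Ideal.mul_mem_left _ c hr)
  rw [← Ideal.unit_mul_mem_iff_mem J hu]
  convert hj using 1
  linear_combination -hc

/-- Each `(x) + (z)` with `z ∈ 𝔪` is an OA-ideal, so it is prime or contains `𝔪²`. If `(x)` is prime
and `y ∈ 𝔪 \ (x)`, then `(x, yⁿ⁺²)` cannot be prime, by Nakayama, so it contains `𝔪²`. Thus `y² ∈
(x, y³)`, whence `y² ∈ (x)`, a contradiction. -/
theorem IsOAFRing.sq_le_span_singleton (h : IsOAFRing R) {x : R} (hx : x ∈ maximalIdeal R)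
    (hx2 : x ∉ maximalIdeal R ^ 2) : maximalIdeal R ^ 2 ≤ Ideal.span {x} := by
  have hne : ∀ z ∈ maximalIdeal R, IsOAIdeal (Ideal.span {x} ⊔ Ideal.span {z}) := fun z hz =>
    h.isOAIdeal_of_not_le_sq
      (fun ht => (maximalIdeal.isMaximal R).ne_top (top_le_iff.1 (ht ▸ sup_le
        ((Ideal.span_singleton_le_iff_mem _).2 hx) ((Ideal.span_singleton_le_iff_mem _).2 hz))))
      (fun hle => hx2 (hle (Ideal.mem_sup_left (Ideal.mem_span_singleton_self x))))
  have hx0 : IsOAIdeal (Ideal.span {x}) := by simpa using hne 0 (zero_mem _)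
  rcases hx0.isPrime_or_sq_le with hp | hle
  · by_cases hm : maximalIdeal R ≤ Ideal.span {x}
    · exact (Ideal.pow_le_self two_ne_zero).trans hm
    obtain ⟨y, hy, hyx⟩ := Set.not_subset.1 hm
    exfalso
    have key : ∀ n : ℕ, maximalIdeal R ^ 2 ≤ Ideal.span {x} ⊔ Ideal.span {y ^ n * y * y} := by
      intro n
      have hmem : y ^ n * y ∈ maximalIdeal R := Ideal.mul_mem_left _ _ hy
      refine (hne _ (Ideal.mul_mem_left _ _ hy)).isPrime_or_sq_le.resolve_left fun hq => hyx ?_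
      refine mem_of_mem_sup_span_mul hmem (hq.mem_of_pow_mem (n + 2) ?_)
      refine Ideal.mem_sup_right ?_
      convert Ideal.mem_span_singleton_self _ using 1
      ring
    have h2 : y * y ∈ maximalIdeal R ^ 2 := by rw [pow_two]; exact Ideal.mul_mem_mul hy hy
    have h3 := key 1 h2
    have h4 : y * y ∈ Ideal.span {x} := mem_of_mem_sup_span_mul hy (by simpa [mul_assoc] using h3)
    rcases hp.mem_or_mem h4 with h5 | h5 <;> exact hyx h5
  · exact hle

theorem IsOAFRing.isDividedIdeal_sq (h : IsOAFRing R) : IsDividedIdeal (maximalIdeal R ^ 2) := by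
  intro J
  by_cases hJ : J ≤ maximalIdeal R ^ 2
  · exact Or.inr hJ
  obtain ⟨x, hxJ, hx2⟩ := Set.not_subset.1 hJ
  left
  by_cases hx : x ∈ maximalIdeal R
  · exact (h.sq_le_span_singleton hx hx2).trans ((Ideal.span_singleton_le_iff_mem _).2 hxJ)
  · rw [J.eq_top_of_isUnit_mem hxJ (notMem_maximalIdeal.1 hx)]
    exact le_top

/-- Dividedness gives `𝔪² ≤ (x)`; in `cx ∈ 𝔪²` the coefficient `c` is a nonunit, since `x ∉ 𝔪²`. -/
theorem IsDividedIdeal.sq_eq_span_mul (h : IsDividedIdeal (maximalIdeal R ^ 2)) {x : R}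
    (hx : x ∈ maximalIdeal R) (hx2 : x ∉ maximalIdeal R ^ 2) :
    maximalIdeal R ^ 2 = Ideal.span {x} * maximalIdeal R := by
  apply le_antisymm
  · intro y hy
    have hle : maximalIdeal R ^ 2 ≤ Ideal.span {x} :=
      (h _).resolve_right fun hle => hx2 (hle (Ideal.mem_span_singleton_self x))
    obtain ⟨c, rfl⟩ := Ideal.mem_span_singleton'.1 (hle hy)
    rw [mul_comm (Ideal.span {x})]
    refine Ideal.mul_mem_mul ?_ (Ideal.mem_span_singleton_self x)
    by_contra hc
    exact hx2 ((Ideal.unit_mul_mem_iff_mem _ (notMem_maximalIdeal.1 hc)).1 hy)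
  · rw [pow_two]
    exact Ideal.mul_mono_left ((Ideal.span_singleton_le_iff_mem _).2 hx)

theorem IsDividedIdeal.pow_add_one_eq_span_mul (h : IsDividedIdeal (maximalIdeal R ^ 2)) {x : R}
    (hx : x ∈ maximalIdeal R) (hx2 : x ∉ maximalIdeal R ^ 2) (n : ℕ) :
    maximalIdeal R ^ (n + 1) = Ideal.span {x} ^ n * maximalIdeal R := by
  induction n with
  | zero => simp
  | succ n ih =>
    rw [pow_succ, ih, mul_assoc, ← pow_two, h.sq_eq_span_mul hx hx2, pow_succ, mul_assoc]

/-- A prime ideal avoiding `x ∈ 𝔪 \ 𝔪²` lies in `x` times itself, if `𝔪²` is divided. -/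
theorem IsDividedIdeal.prime_le_span_mul (h : IsDividedIdeal (maximalIdeal R ^ 2)) {x : R}
    (hx : x ∈ maximalIdeal R) (hx2 : x ∉ maximalIdeal R ^ 2) {J : Ideal R} (hJ : J.IsPrime)
    (hxJ : x ∉ J) : J ≤ Ideal.span {x} * J := by
  have hJ2 : J ≤ maximalIdeal R ^ 2 := (h J).resolve_left fun hle =>
    hxJ (hJ.mem_of_pow_mem 2 (hle (Ideal.pow_mem_pow hx 2)))
  intro y hy
  have hy2 := hJ2 hy
  rw [h.sq_eq_span_mul hx hx2, Ideal.mem_span_singleton_mul] at hy2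
  obtain ⟨z, -, rfl⟩ := hy2
  exact Ideal.mul_mem_mul (Ideal.mem_span_singleton_self x) ((hJ.mem_or_mem hy).resolve_left hxJ)

/-- A factor `J` of `(y)` not containing `𝔪²` would be prime and avoid `x`, so `J ≤ xJ` and `y ∈
(xy)`, forcing `y = 0`. -/
theorem IsOAFRing.exists_pow_le_span_singleton (h : IsOAFRing R) {x : R}
    (hx : x ∈ maximalIdeal R) (hx2 : x ∉ maximalIdeal R ^ 2) {y : R} (hy : y ≠ 0) :
    ∃ k, maximalIdeal R ^ k ≤ Ideal.span {y} := by
  have hd := h.isDividedIdeal_sq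
  by_cases hyu : IsUnit y
  · exact ⟨0, by rw [Ideal.span_singleton_eq_top.2 hyu]; exact le_top⟩
  obtain ⟨s, hs, hsy⟩ := h (Ideal.span {y}) (by rwa [Ne, Ideal.span_singleton_eq_top])
  by_cases hall : ∀ J ∈ s, maximalIdeal R ^ 2 ≤ J
  · refine ⟨2 * Multiset.card s, ?_⟩
    rw [pow_mul, ← hsy]
    exact Ideal.pow_card_le_multiset_prod hall
  · push Not at hall
    obtain ⟨J, hJ, hJ2⟩ := hall
    have hxJ : x ∉ J := fun hxJ => hJ2 (by
      rw [hd.sq_eq_span_mul hx hx2]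
      exact Ideal.mul_le_left.trans ((Ideal.span_singleton_le_iff_mem _).2 hxJ))
    have hJp : J.IsPrime := (hs J hJ).isPrime_or_sq_le.resolve_right hJ2
    obtain ⟨t, rfl⟩ := Multiset.exists_cons_of_mem hJ
    have hmem : y ∈ Ideal.span {x} * Ideal.span {y} := by
      rw [← hsy, Multiset.prod_cons, ← mul_assoc]
      refine Ideal.mul_mono_left (hd.prime_le_span_mul hx hx2 hJp hxJ) ?_
      rw [← Multiset.prod_cons, hsy]
      exact Ideal.mem_span_singleton_self y
    rw [Ideal.span_singleton_mul_span_singleton] at hmem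
    obtain ⟨c, hc⟩ := Ideal.mem_span_singleton'.1 hmem
    exact absurd (eq_zero_of_mem_maximalIdeal_of_mul_eq (Ideal.mul_mem_left _ c hx)
      (by rw [mul_assoc, hc])) hy

theorem IsOAFRing.iInf_pow_eq_bot (h : IsOAFRing R) {x : R} (hx : x ∈ maximalIdeal R)
    (hx2 : x ∉ maximalIdeal R ^ 2) : ⨅ n : ℕ, maximalIdeal R ^ n = ⊥ := by
  rw [eq_bot_iff]
  intro y hy
  by_contra hy0
  obtain ⟨k, hk⟩ := h.exists_pow_le_span_singleton hx hx2 hy0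
  -- Since `𝔪ᵏ⁺² = x𝔪ᵏ⁺¹` and `𝔪ᵏ⁺¹ ≤ (y)`, the exponent `k + 2` makes `y` a multiple of `xy`.
  have hy' := (Submodule.mem_iInf _).1 hy (k + 1 + 1)
  rw [h.isDividedIdeal_sq.pow_add_one_eq_span_mul hx hx2, pow_succ', mul_assoc,
    ← h.isDividedIdeal_sq.pow_add_one_eq_span_mul hx hx2, Ideal.mem_span_singleton_mul] at hy'
  obtain ⟨z, hz, hzy⟩ := hy'
  obtain ⟨c, rfl⟩ := Ideal.mem_span_singleton'.1 (hk (Ideal.pow_le_pow_right (Nat.le_succ k) hz))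
  exact hy0 (eq_zero_of_mem_maximalIdeal_of_mul_eq (Ideal.mul_mem_left _ c hx)
    (by linear_combination -hzy))

theorem IsOAFRing.isNilpotent_or_isDomain_of_notMem_sq (h : IsOAFRing R) {x : R}
    (hx : x ∈ maximalIdeal R) (hx2 : x ∉ maximalIdeal R ^ 2) :
    IsNilpotent (maximalIdeal R) ∨ (IsDomain R ∧ ⨅ n : ℕ, maximalIdeal R ^ n = ⊥) := by
  have hd := h.isDividedIdeal_sq
  obtain ⟨s, hs, hs0⟩ := h ⊥ bot_ne_top
  by_cases hall : ∀ J ∈ s, maximalIdeal R ^ 2 ≤ J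
  · left
    refine ⟨2 * Multiset.card s, ?_⟩
    rw [pow_mul, Ideal.zero_eq_bot, eq_bot_iff, ← hs0]
    exact Ideal.pow_card_le_multiset_prod hall
  · right
    push Not at hall
    obtain ⟨J, hJ, hJ2⟩ := hall
    have hxJ : x ∉ J := fun hxJ => hJ2 (by
      rw [hd.sq_eq_span_mul hx hx2]
      exact Ideal.mul_le_left.trans ((Ideal.span_singleton_le_iff_mem _).2 hxJ))
    have hJp : J.IsPrime := (hs J hJ).isPrime_or_sq_le.resolve_right hJ2
    have hinf := h.iInf_pow_eq_bot hx hx2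
    refine ⟨?_, hinf⟩
    -- Iterating `J ≤ xJ` puts `J` in every `𝔪ⁿ`, so the zero ideal is the prime `J`.
    have hpow : ∀ n, J ≤ Ideal.span {x} ^ n * J := by
      intro n
      induction n with
      | zero => simp
      | succ n ih =>
        calc J ≤ Ideal.span {x} ^ n * J := ih
          _ ≤ Ideal.span {x} ^ n * (Ideal.span {x} * J) :=
            Ideal.mul_mono_right (hd.prime_le_span_mul hx hx2 hJp hxJ)
          _ = _ := by rw [pow_succ, mul_assoc]
    have hJ0 : J = ⊥ := by
      rw [eq_bot_iff, ← hinf]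
      refine le_iInf fun n => (hpow n).trans (Ideal.mul_le_left.trans ?_)
      exact Ideal.pow_right_mono ((Ideal.span_singleton_le_iff_mem _).2 hx) n
    subst hJ0
    exact IsDomain.of_bot_isPrime R

/-! ### Local general ZPI-rings with idempotent maximal ideal -/

/-- A nonzero principal ideal of a local domain only has principal factors. -/
theorem exists_eq_span_singleton_of_mul_eq [IsDomain R] {Q B : Ideal R} {x : R} (hx : x ≠ 0)
    (h : Q * B = Ideal.span {x}) : ∃ q, Q = Ideal.span {q} := by
  have hex : ∃ q ∈ Q, ∃ b ∈ B, x ∣ q * b ∧ q * b ∣ x := by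
    -- If no single product `qb` were an associate of `x`, all of `QB` would lie in `x𝔪`, and `x ∈
    -- x𝔪` forces `x = 0`.
    by_contra! hcon
    have hle : Q * B ≤ Ideal.span {x} * maximalIdeal R := by
      rw [Ideal.mul_le]
      intro q hq b hb
      obtain ⟨c, hc⟩ := Ideal.mem_span_singleton'.1 (h ▸ Ideal.mul_mem_mul hq hb)
      rw [← hc, mul_comm c]
      refine Ideal.mul_mem_mul (Ideal.mem_span_singleton_self x) ?_
      by_contra hcu
      obtain ⟨u, rfl⟩ := notMem_maximalIdeal.1 hcu
      exact hcon q hq b hb ⟨u, by rw [← hc, mul_comm]⟩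
        ⟨((u⁻¹ : Rˣ) : R), by rw [← hc, mul_right_comm, Units.mul_inv, one_mul]⟩
    have hmem := hle (h ▸ Ideal.mem_span_singleton_self x)
    obtain ⟨z, hz, hzx⟩ := Ideal.mem_span_singleton_mul.1 hmem
    exact hx (eq_zero_of_mem_maximalIdeal_of_mul_eq hz (by linear_combination -hzx))
  obtain ⟨q, hq, b, hb, hdvd, hdvd'⟩ := hex
  have hb0 : b ≠ 0 := by
    rintro rfl
    exact hx (by simpa using hdvd')
  refine ⟨q, le_antisymm (fun y hy => ?_) ((Ideal.span_singleton_le_iff_mem _).2 hq)⟩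
  obtain ⟨c, hc⟩ := Ideal.mem_span_singleton'.1 (h ▸ Ideal.mul_mem_mul hy hb)
  obtain ⟨d, hd⟩ := hdvd'
  refine Ideal.mem_span_singleton'.2 ⟨c * d, mul_right_cancel₀ hb0 ?_⟩
  rw [← hc]
  linear_combination -c * hd

theorem IsGeneralZPIRing.exists_prime [IsDomain R] (h : IsGeneralZPIRing R)
    (hm : maximalIdeal R ≠ ⊥) : ∃ p : R, Prime p := by
  obtain ⟨x, hx, hx0⟩ := Submodule.exists_mem_ne_zero_of_ne_bot hm
  obtain ⟨s, hs, hsx⟩ := h (Ideal.span {x}) (by rwa [Ne, Ideal.span_singleton_eq_top])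
  induction s using Multiset.induction_on with
  | empty => exact absurd (by simpa using hsx.symm) hx
  | cons Q s _ =>
    rw [Multiset.prod_cons] at hsx
    obtain ⟨q, rfl⟩ := exists_eq_span_singleton_of_mul_eq hx0 hsx
    refine ⟨q, (Ideal.span_singleton_prime ?_).1 (hs _ (by simp))⟩
    rintro rfl
    exact hx0 (by simpa using hsx.symm)

/-- A local domain with idempotent maximal ideal in which every ideal is a product of primes is a
field. -/
theorem IsGeneralZPIRing.maximalIdeal_eq_bot_of_isDomain [IsDomain R] (h : IsGeneralZPIRing R)
    (hm : maximalIdeal R ^ 2 = maximalIdeal R) : maximalIdeal R = ⊥ := by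
  by_contra hne
  obtain ⟨p, hp⟩ := h.exists_prime hne
  have hpp : (Ideal.span {p}).IsPrime := (Ideal.span_singleton_prime hp.ne_zero).2 hp
  have hpm : p ∈ maximalIdeal R := hp.not_isUnit
  -- Idempotence enters here: `𝔪 ≤ (p)` would give `p ∈ 𝔪² ≤ (p²)`. So `R/(p)` is not a field and
  -- has a prime element, the class of some `y`.
  have hpne : ¬ maximalIdeal R ≤ Ideal.span {p} := fun hle => by
    have hmem : p ∈ Ideal.span {p * p} := by
      rw [← Ideal.span_singleton_mul_span_singleton]
      rw [← hm, pow_two] at hpm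
      exact Ideal.mul_mono hle hle hpm
    obtain ⟨c, hc⟩ := Ideal.mem_span_singleton'.1 hmem
    exact hp.ne_zero (eq_zero_of_mem_maximalIdeal_of_mul_eq (Ideal.mul_mem_left _ c hp.not_isUnit)
      (by linear_combination -hc))
  let S := R ⧸ Ideal.span {p}
  let f : R →+* S := Ideal.Quotient.mk _
  have hf : Function.Surjective f := Ideal.Quotient.mk_surjective
  have hfp : f p = 0 := Ideal.Quotient.eq_zero_iff_mem.2 (Ideal.mem_span_singleton_self p)
  have : IsLocalRing S := IsLocalRing.of_surjective' f hf
  have hS : IsGeneralZPIRing S := h.of_surjective f hf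
  have hSm : maximalIdeal S ≠ ⊥ := by
    rw [← map_maximalIdeal_of_surjective f hf, Ne, Ideal.map_eq_bot_iff_le_ker, Ideal.mk_ker]
    exact hpne
  obtain ⟨y, hy⟩ := hS.exists_prime hSm
  obtain ⟨y, rfl⟩ := hf y
  have hym : y ∈ maximalIdeal R := fun hu => hy.not_isUnit (hu.map f)
  set T : Ideal R := Ideal.span {p} ⊔ Ideal.span {y} with hT
  have hTmap : T.map f = Ideal.span {f y} := by
    rw [hT, Ideal.map_sup, Ideal.map_span, Ideal.map_span, Set.image_singleton,
      Set.image_singleton, hfp]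
    simp
  have hker : RingHom.ker f = Ideal.span {p} := Ideal.mk_ker
  obtain ⟨s, hs, hsy⟩ := h (Ideal.span {p} ⊔ Ideal.span {y * y}) (fun ht =>
    (maximalIdeal.isMaximal R).ne_top (top_le_iff.1 (ht ▸ sup_le
      ((Ideal.span_singleton_le_iff_mem _).2 hpm)
      ((Ideal.span_singleton_le_iff_mem _).2 (Ideal.mul_mem_left _ _ hym)))))
  have hsmap : (s.map (Ideal.map f)).prod = Ideal.span {f y * f y} := by
    rw [← Ideal.map_multiset_prod_eq, hsy, Ideal.map_sup, Ideal.map_span, Ideal.map_span,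
      Set.image_singleton, Set.image_singleton, hfp]
    simp
  -- Modulo `p`, a prime factor of `(p, y²)` becomes a principal factor of `(y²)` containing the
  -- prime `y`, so it is `(y)`. Hence `(p, y²)` is a power of `T = (p, y)`.
  have hall : ∀ Q ∈ s, Q = T := by
    intro Q hQ
    have hpQ : Ideal.span {p} ≤ Q :=
      le_sup_left.trans (hsy ▸ Ideal.multiset_prod_le_of_mem hQ)
    have hTQ : T ≤ Q := by
      refine sup_le hpQ ((Ideal.span_singleton_le_iff_mem _).2 ?_)
      have : y * y ∈ Q := Ideal.multiset_prod_le_of_mem hQ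
        (hsy ▸ Ideal.mem_sup_right (Ideal.mem_span_singleton_self _))
      exact ((hs Q hQ).mem_or_mem this).elim id id
    have hQmap : Q.map f ∈ s.map (Ideal.map f) := Multiset.mem_map_of_mem _ hQ
    obtain ⟨t, ht⟩ := Multiset.exists_cons_of_mem hQmap
    rw [ht, Multiset.prod_cons] at hsmap
    obtain ⟨q, hq⟩ := exists_eq_span_singleton_of_mul_eq
      (mul_ne_zero hy.ne_zero hy.ne_zero) hsmap
    have hyq : f y ∈ Ideal.span {q} := by
      rw [← hq]
      exact Ideal.mem_map_of_mem f (hTQ (Ideal.mem_sup_right (Ideal.mem_span_singleton_self _)))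
    have hqne : ¬ IsUnit q := by
      rw [← Ideal.span_singleton_eq_top, ← hq]
      exact (Ideal.map_isPrime_of_surjective hf (hker.le.trans hpQ) (H := hs Q hQ)).ne_top
    have hspan : Ideal.span {q} = Ideal.span {f y} :=
      Ideal.span_singleton_eq_span_singleton.2
        ((hy.irreducible.dvd_iff.1 (Ideal.mem_span_singleton.1 hyq)).resolve_left hqne).symm
    have := congrArg (Ideal.comap f) (hq.trans (hspan.trans hTmap.symm))
    rwa [Ideal.comap_map_of_surjective' f hf, Ideal.comap_map_of_surjective' f hf, hker,
      sup_eq_left.2 hpQ, sup_eq_left.2 le_sup_left] at this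
  have hTm : T ≤ maximalIdeal R := sup_le ((Ideal.span_singleton_le_iff_mem _).2 hpm)
      ((Ideal.span_singleton_le_iff_mem _).2 hym)
  rw [Multiset.eq_replicate_card.2 hall, Multiset.prod_replicate] at hsy
  have hyT : y ∈ T := Ideal.mem_sup_right (Ideal.mem_span_singleton_self _)
  have hyp : y ∉ Ideal.span {p} := fun hyp =>
    hy.ne_zero (Ideal.Quotient.eq_zero_iff_mem.2 hyp)
  -- Exponent 0 would make `(p, y²)` the unit ideal; exponent 1 would put `y` in `(p, y²)`, hence in
  -- `(p)`.
  have hle : T ^ Multiset.card s ≤ T ^ 2 := by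
    rcases hc : Multiset.card s with _ | _ | n
    · rw [hc, pow_zero, Ideal.one_eq_top] at hsy
      refine absurd (hsy.le.trans ?_) (fun h => (maximalIdeal.isMaximal R).ne_top
        (top_le_iff.1 h))
      exact sup_le ((Ideal.span_singleton_le_iff_mem _).2 hpm)
        ((Ideal.span_singleton_le_iff_mem _).2 (Ideal.mul_mem_left _ _ hym))
    · rw [hc, zero_add, pow_one] at hsy
      rw [hsy] at hyT
      exact absurd (mem_of_mem_sup_span_mul hym hyT) hyp
    · exact Ideal.pow_le_pow_right (by omega)
  have hpT : p ∈ T ^ 2 := hle (hsy ▸ Ideal.mem_sup_left (Ideal.mem_span_singleton_self _))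
  have hTsq : T ^ 2 ≤ Ideal.span {p} * maximalIdeal R ⊔ Ideal.span {y * y} := by
    rw [pow_two]
    nth_rw 1 [hT]
    rw [Ideal.sup_mul]
    refine sup_le ((Ideal.mul_mono_right hTm).trans le_sup_left) ?_
    rw [hT, Ideal.mul_sup, Ideal.span_singleton_mul_span_singleton y y]
    refine sup_le (le_sup_of_le_left ?_) le_sup_right
    rw [mul_comm]
    exact Ideal.mul_mono_right ((Ideal.span_singleton_le_iff_mem _).2 hym)
  obtain ⟨u, hu, v, hv, huv⟩ := Submodule.mem_sup.1 (hTsq hpT)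
  obtain ⟨a, ha, rfl⟩ := Ideal.mem_span_singleton_mul.1 hu
  obtain ⟨c, rfl⟩ := Ideal.mem_span_singleton'.1 hv
  -- From `p = pa + cy²` with `a ∈ 𝔪` and `y ∉ (p)`, the coefficient `c` is divisible by `p`; then
  -- `p ∈ p𝔪`, which is absurd.
  have hcp : c ∈ Ideal.span {p} := by
    have : c * (y * y) ∈ Ideal.span {p} :=
      Ideal.mem_span_singleton'.2 ⟨1 - a, by linear_combination -huv⟩
    rcases hpp.mem_or_mem this with h1 | h1
    · exact h1
    · exact absurd ((hpp.mem_or_mem h1).elim id id) hyp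
  obtain ⟨d, rfl⟩ := Ideal.mem_span_singleton'.1 hcp
  refine hp.ne_zero (eq_zero_of_mem_maximalIdeal_of_mul_eq (r := a + d * y * y) ?_ ?_)
  · exact add_mem ha (Ideal.mul_mem_left _ _ hym)
  · linear_combination -huv

/-- By the domain case every quotient by a prime is a field, so `𝔪` is the only prime. Zero is then
a power of the idempotent `𝔪`. -/
theorem IsGeneralZPIRing.maximalIdeal_eq_bot (h : IsGeneralZPIRing R)
    (hm : maximalIdeal R ^ 2 = maximalIdeal R) : maximalIdeal R = ⊥ := by
  have hprime : ∀ Q : Ideal R, Q.IsPrime → maximalIdeal R ≤ Q := by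
    intro Q hQ
    let f : R →+* R ⧸ Q := Ideal.Quotient.mk _
    have hf : Function.Surjective f := Ideal.Quotient.mk_surjective
    have : IsLocalRing (R ⧸ Q) := IsLocalRing.of_surjective' f hf
    have hmap : (maximalIdeal R).map f = maximalIdeal (R ⧸ Q) :=
      map_maximalIdeal_of_surjective f hf
    have := (h.of_surjective f hf).maximalIdeal_eq_bot_of_isDomain
      (by rw [← hmap, ← Ideal.map_pow, hm])
    rw [← hmap, Ideal.map_eq_bot_iff_le_ker, Ideal.mk_ker] at this
    exact this
  obtain ⟨s, hs, hs0⟩ := h ⊥ bot_ne_top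
  have hle := Ideal.pow_card_le_multiset_prod fun Q hQ => hprime Q (hs Q hQ)
  rw [eq_bot_iff, ← hs0]
  exact (Ideal.le_pow_of_mul_self_eq (by rw [← pow_two, hm]) _).trans hle

/-! ### Characterization of local OAF-rings -/

theorem IsOAFRing.isNilpotent_or_isDomain (h : IsOAFRing R) :
    IsNilpotent (maximalIdeal R) ∨ (IsDomain R ∧ ⨅ n : ℕ, maximalIdeal R ^ n = ⊥) := by
  by_cases hm : maximalIdeal R ≤ maximalIdeal R ^ 2
  · have hm' := le_antisymm (Ideal.pow_le_self two_ne_zero) hm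
    refine Or.inl ⟨1, ?_⟩
    rw [pow_one]
    -- When `𝔪² = 𝔪`, a nonprime OA-ideal would contain `𝔪² = 𝔪`, hence equal it; so the ring is
    -- general ZPI.
    refine IsGeneralZPIRing.maximalIdeal_eq_bot (fun I hI => (h I hI).mono fun J hJ => ?_) hm'
    refine hJ.isPrime_or_sq_le.elim id fun hle => ?_
    rw [hm'] at hle
    rw [← (maximalIdeal.isMaximal R).eq_of_le hJ.1 hle]
    infer_instance
  · obtain ⟨x, hx, hx2⟩ := Set.not_subset.1 hm
    exact h.isNilpotent_or_isDomain_of_notMem_sq hx hx2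

theorem IsDividedIdeal.isOAFRing (hd : IsDividedIdeal (maximalIdeal R ^ 2))
    (hm : IsNilpotent (maximalIdeal R) ∨ (IsDomain R ∧ ⨅ n : ℕ, maximalIdeal R ^ n = ⊥)) :
    IsOAFRing R := by
  have hinf : ⨅ n : ℕ, maximalIdeal R ^ n = ⊥ := by
    rcases hm with ⟨n, hn⟩ | h
    · exact eq_bot_iff.2 ((iInf_le _ n).trans hn.le)
    · exact h.2
  have hmOA : IsOAIdeal (maximalIdeal R) := Ideal.IsPrime.isOAIdeal inferInstance
  intro I hI
  by_cases hI0 : I = ⊥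
  · subst hI0
    rcases hm with ⟨n, hn⟩ | ⟨_, -⟩
    · rw [← Ideal.zero_eq_bot, ← hn]
      exact (IsProductOf.of_self hmOA).pow n
    · exact .of_self (Ideal.isPrime_bot.isOAIdeal)
  by_cases hI2 : maximalIdeal R ^ 2 ≤ I
  · exact .of_self (isOAIdeal_of_sq_le hI hI2)
  have hI2' := (hd I).resolve_left hI2
  classical
  have hex : ∃ n, ¬ I ≤ maximalIdeal R ^ n := by
    by_contra! hcon
    exact hI0 (eq_bot_iff.2 (hinf ▸ le_iInf hcon))
  have hmne : ¬ maximalIdeal R ≤ maximalIdeal R ^ 2 := by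
    intro hle
    obtain ⟨n, hn⟩ := hex
    exact hn ((le_maximalIdeal hI).trans (Ideal.le_pow_of_mul_self_eq
      (le_antisymm Ideal.mul_le_left (hle.trans (pow_two _).le)) n))
  obtain ⟨x, hx, hx2⟩ := Set.not_subset.1 hmne
  have hspec := Nat.find_spec hex
  have hmin : ∀ k < Nat.find hex, I ≤ maximalIdeal R ^ k := fun k hk => by
    simpa using Nat.find_min hex hk
  obtain ⟨n, hn⟩ : ∃ n, Nat.find hex = n + 2 := by
    rcases hc : Nat.find hex with _ | _ | n
    · rw [hc] at hspec; simp at hspec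
    · rw [hc] at hspec; simp at hspec; exact absurd (le_maximalIdeal hI) hspec
    · exact ⟨n, rfl⟩
  have hIn := hmin (n + 1) (by omega)
  rw [hn] at hspec
  rw [hd.pow_add_one_eq_span_mul hx hx2, Ideal.span_singleton_pow] at hIn
  -- Here `n + 2` is the least exponent with `I ≰ 𝔪ⁿ⁺²`, so `I ≤ 𝔪ⁿ⁺¹ = xⁿ𝔪` and `I = xⁿJ`. If `J ≤
  -- 𝔪²`, then `I ≤ xⁿ𝔪² = 𝔪ⁿ⁺²`; so `J`, like `(x)`, contains `𝔪²` and is an OA-ideal.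
  set J : Ideal R := maximalIdeal R ⊓ Submodule.colon I ({x ^ n} : Set R) with hJ
  have hIJ : I = Ideal.span {x} ^ n * J := by
    rw [Ideal.span_singleton_pow]
    apply le_antisymm
    · intro y hy
      obtain ⟨z, hz, rfl⟩ := Ideal.mem_span_singleton_mul.1 (hIn hy)
      refine Ideal.mul_mem_mul (Ideal.mem_span_singleton_self _) ⟨hz, ?_⟩
      exact Submodule.mem_colon_singleton.2 (by rwa [smul_eq_mul, mul_comm])
    · intro y hy
      obtain ⟨z, hz, rfl⟩ := Ideal.mem_span_singleton_mul.1 hy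
      have := Submodule.mem_colon_singleton.1 hz.2
      rwa [smul_eq_mul, mul_comm] at this
  have hJ2 : maximalIdeal R ^ 2 ≤ J := by
    refine (hd J).resolve_right fun hle => hspec ?_
    rw [hIJ, hd.pow_add_one_eq_span_mul hx hx2 (n + 1), pow_succ, mul_assoc,
      ← hd.sq_eq_span_mul hx hx2]
    exact Ideal.mul_mono_right hle
  rw [hIJ]
  have htop : ∀ K ≤ maximalIdeal R, K ≠ ⊤ := fun K hK h =>
    (maximalIdeal.isMaximal R).ne_top (top_le_iff.1 (h ▸ hK))
  refine (IsProductOf.of_self (isOAIdeal_of_sq_le ?_ ?_)).pow n |>.mul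
    (.of_self (isOAIdeal_of_sq_le (htop J inf_le_left) hJ2))
  · exact htop _ ((Ideal.span_singleton_le_iff_mem _).2 hx)
  · rw [hd.sq_eq_span_mul hx hx2]
    exact Ideal.mul_le_left

theorem isOAFRing_iff_of_isLocalRing : IsOAFRing R ↔ IsDividedIdeal (maximalIdeal R ^ 2) ∧
    (IsNilpotent (maximalIdeal R) ∨ (IsDomain R ∧ ⨅ n : ℕ, maximalIdeal R ^ n = ⊥)) :=
  ⟨fun h => ⟨h.isDividedIdeal_sq, h.isNilpotent_or_isDomain⟩, fun h => h.1.isOAFRing h.2⟩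

end Local

/-! ### Homogeneous ideals of the trivial extension -/

namespace TrivSqZeroExt

variable {A E : Type*} [CommRing A] [AddCommGroup E] [Module A E] [Module Aᵐᵒᵖ E]
  [IsCentralScalar A E]

/-- The homogeneous ideal `C ∝ F` of `A ∝ E`. -/
def homogeneousIdeal (C : Ideal A) (F : Submodule A E) (h : C • (⊤ : Submodule A E) ≤ F) :
    Ideal (TrivSqZeroExt A E) where
  carrier := {x | x.fst ∈ C ∧ x.snd ∈ F}
  add_mem' hx hy := ⟨C.add_mem hx.1 hy.1, F.add_mem hx.2 hy.2⟩
  zero_mem' := ⟨C.zero_mem, F.zero_mem⟩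
  smul_mem' r x hx := by
    refine ⟨C.mul_mem_left _ hx.1, ?_⟩
    rw [smul_eq_mul, snd_mul, op_smul_eq_smul]
    exact F.add_mem (F.smul_mem _ hx.2) (h (Submodule.smul_mem_smul hx.1 trivial))

@[simp]
theorem mem_homogeneousIdeal {C : Ideal A} {F : Submodule A E}
    {h : C • (⊤ : Submodule A E) ≤ F} {x : TrivSqZeroExt A E} :
    x ∈ homogeneousIdeal C F h ↔ x.fst ∈ C ∧ x.snd ∈ F := Iff.rfl

theorem mem_of_inl_mem_of_inr_mem {J : Ideal (TrivSqZeroExt A E)} {x : TrivSqZeroExt A E}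
    (h₁ : inl x.fst ∈ J) (h₂ : inr x.snd ∈ J) : x ∈ J := by
  rw [← inl_fst_add_inr_snd_eq x]
  exact J.add_mem h₁ h₂

theorem homogeneousIdeal_mul {C D : Ideal A} {F G : Submodule A E}
    (hF : C • (⊤ : Submodule A E) ≤ F) (hG : D • (⊤ : Submodule A E) ≤ G)
    (h : (C * D) • (⊤ : Submodule A E) ≤ C • G ⊔ D • F) :
    homogeneousIdeal C F hF * homogeneousIdeal D G hG =
      homogeneousIdeal (C * D) (C • G ⊔ D • F) h := by
  apply le_antisymm
  · rw [Ideal.mul_le]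
    intro x hx y hy
    refine ⟨Ideal.mul_mem_mul hx.1 hy.1, ?_⟩
    rw [snd_mul, op_smul_eq_smul]
    exact Submodule.add_mem_sup (Submodule.smul_mem_smul hx.1 hy.2)
      (Submodule.smul_mem_smul hy.1 hx.2)
  · intro x hx
    refine mem_of_inl_mem_of_inr_mem ?_ ?_
    · have hle : C * D ≤ Ideal.comap (inlHom A E)
          (homogeneousIdeal C F hF * homogeneousIdeal D G hG) := by
        rw [Ideal.mul_le]
        intro c hc d hd
        rw [Ideal.mem_comap, map_mul]
        exact Ideal.mul_mem_mul ⟨hc, F.zero_mem⟩ ⟨hd, G.zero_mem⟩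
      exact hle hx.1
    · obtain ⟨y, hy, z, hz, hyz⟩ := Submodule.mem_sup.1 hx.2
      rw [← hyz, inr_add]
      refine Ideal.add_mem _ ?_ ?_
      · refine Submodule.smul_induction_on hy (fun c hc g hg => ?_) fun a b ha hb => ?_
        · rw [← inl_mul_inr]
          exact Ideal.mul_mem_mul ⟨hc, F.zero_mem⟩ ⟨D.zero_mem, hg⟩
        · rw [inr_add]
          exact Ideal.add_mem _ ha hb
      · refine Submodule.smul_induction_on hz (fun d hd f hf => ?_) fun a b ha hb => ?_
        · rw [← inl_mul_inr, mul_comm (inl d)]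
          exact Ideal.mul_mem_mul ⟨C.zero_mem, hf⟩ ⟨hd, G.zero_mem⟩
        · rw [inr_add]
          exact Ideal.add_mem _ ha hb

theorem homogeneousIdeal_top_sq (P : Ideal A) :
    homogeneousIdeal P (⊤ : Submodule A E) le_top ^ 2 =
      homogeneousIdeal (P ^ 2) (P • ⊤)
        (Submodule.smul_mono_left (Ideal.pow_le_self two_ne_zero)) := by
  rw [pow_two, homogeneousIdeal_mul le_top le_top]
  · ext x
    simp [pow_two]
  · rw [sup_idem]
    exact Submodule.smul_mono_left Ideal.mul_le_left

variable (A E) in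
/-- The projection `A ∝ E → A`. -/
def fstRingHom : TrivSqZeroExt A E →+* A := (fstHom A A E : TrivSqZeroExt A E →+* A)

@[simp]
theorem fstRingHom_apply (x : TrivSqZeroExt A E) : fstRingHom A E x = x.fst := rfl

theorem fstRingHom_surjective : Function.Surjective (fstRingHom A E) := fun a => ⟨inl a, rfl⟩

instance isLocalHom_fstRingHom : IsLocalHom (fstRingHom A E) :=
  ⟨fun _ h => isUnit_iff_isUnit_fst.2 h⟩

omit [IsCentralScalar A E] in
theorem inlHom_surjective [Subsingleton E] : Function.Surjective (inlHom A E) :=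
  fun x => ⟨x.fst, ext rfl (Subsingleton.elim _ _)⟩

instance isLocalHom_inlHom : IsLocalHom (inlHom A E) :=
  ⟨fun _ h => isUnit_inl_iff.1 h⟩

theorem isLocalRing_iff [Nontrivial A] : IsLocalRing (TrivSqZeroExt A E) ↔ IsLocalRing A := by
  refine ⟨fun _ => IsLocalRing.of_surjective' (fstRingHom A E) fstRingHom_surjective, fun _ => ?_⟩
  refine IsLocalRing.of_nonunits_add fun x y hx hy => ?_
  rw [mem_nonunits_iff, isUnit_iff_isUnit_fst] at *
  rw [fst_add]
  exact IsLocalRing.nonunits_add hx hy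

theorem inr_mem_of_isPrime {Q : Ideal (TrivSqZeroExt A E)} (hQ : Q.IsPrime) (e : E) :
    inr e ∈ Q := by
  have : (inr e : TrivSqZeroExt A E) * inr e ∈ Q := by
    rw [inr_mul_inr]
    exact Q.zero_mem
  exact (hQ.mem_or_mem this).elim id id

/-- By `inr_mem_of_isPrime` this applies to every prime. -/
theorem eq_homogeneousIdeal_comap {K : Ideal (TrivSqZeroExt A E)} (hK : ∀ e : E, inr e ∈ K) :
    K = homogeneousIdeal (K.comap (inlHom A E)) ⊤ le_top := by
  ext x
  refine ⟨fun hx => ⟨?_, trivial⟩, fun hx => mem_of_inl_mem_of_inr_mem hx.1 (hK _)⟩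
  rw [Ideal.mem_comap, inlHom_apply, eq_sub_of_add_eq (inl_fst_add_inr_snd_eq x)]
  exact K.sub_mem hx (hK _)

theorem homogeneousIdeal_top_eq_comap (P : Ideal A) :
    homogeneousIdeal P (⊤ : Submodule A E) le_top = P.comap (fstRingHom A E) := by
  ext x
  simp

/-! ### Trivial extensions of local rings and condition (C) -/

section Local

open IsLocalRing

variable [IsLocalRing A] [IsLocalRing (TrivSqZeroExt A E)]

theorem maximalIdeal_eq :
    maximalIdeal (TrivSqZeroExt A E) = homogeneousIdeal (maximalIdeal A) ⊤ le_top := by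
  rw [homogeneousIdeal_top_eq_comap, maximalIdeal_comap]

theorem mem_maximalIdeal_sq {x : TrivSqZeroExt A E} :
    x ∈ maximalIdeal (TrivSqZeroExt A E) ^ 2 ↔
      x.fst ∈ maximalIdeal A ^ 2 ∧ x.snd ∈ maximalIdeal A • (⊤ : Submodule A E) := by
  rw [maximalIdeal_eq, homogeneousIdeal_top_sq, mem_homogeneousIdeal]

theorem maximalIdeal_sq_eq_bot_iff :
    maximalIdeal (TrivSqZeroExt A E) ^ 2 = ⊥ ↔
      maximalIdeal A ^ 2 = ⊥ ∧ maximalIdeal A • (⊤ : Submodule A E) = ⊥ := by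
  constructor
  · intro h
    constructor
    · rw [eq_bot_iff]
      intro a ha
      have hmem : (inl a : TrivSqZeroExt A E) ∈ maximalIdeal (TrivSqZeroExt A E) ^ 2 :=
        mem_maximalIdeal_sq.2 ⟨ha, Submodule.zero_mem _⟩
      rw [h] at hmem
      exact congrArg fst hmem
    · rw [eq_bot_iff]
      intro e he
      have hmem : (inr e : TrivSqZeroExt A E) ∈ maximalIdeal (TrivSqZeroExt A E) ^ 2 :=
        mem_maximalIdeal_sq.2 ⟨Submodule.zero_mem _, he⟩
      rw [h] at hmem
      exact congrArg snd hmem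
  · rintro ⟨h₁, h₂⟩
    rw [eq_bot_iff]
    intro x hx
    rw [mem_maximalIdeal_sq, h₁, h₂] at hx
    exact ext hx.1 hx.2

/-- Nilpotence replaces finite generation in Nakayama: `𝔪E = E` would give `E = 𝔪ⁿE = 0`. -/
theorem smul_top_ne_top_of_isNilpotent [Nontrivial E]
    (h : IsNilpotent (maximalIdeal (TrivSqZeroExt A E))) :
    maximalIdeal A • (⊤ : Submodule A E) ≠ ⊤ := by
  obtain ⟨n, hn⟩ := h
  intro htop
  have hpow : ∀ n : ℕ, maximalIdeal A ^ n • (⊤ : Submodule A E) = ⊤ := by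
    intro n
    induction n with
    | zero => rw [pow_zero, Ideal.one_eq_top, Submodule.top_smul]
    | succ n ih => rw [pow_succ, Submodule.mul_smul, htop, ih]
  have hA : maximalIdeal A ^ n = ⊥ := by
    rw [← map_maximalIdeal_of_surjective (fstRingHom A E) fstRingHom_surjective, ← Ideal.map_pow,
      hn, Ideal.zero_eq_bot, Ideal.map_bot]
  have := hpow n
  rw [hA, Submodule.bot_smul] at this
  exact bot_ne_top this

/-- Elements outside the divided ideal `𝔪² ∝ 𝔪E` generate ideals containing it. The three claims
compare coordinates for `inr e` with `e ∉ 𝔪E`, `inl a` and `inr x`. -/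
theorem conditions_of_isOAFRing [Nontrivial E] (h : IsOAFRing (TrivSqZeroExt A E)) :
    maximalIdeal A ^ 2 = ⊥ ∧
      (∀ a ∈ maximalIdeal A, a ≠ 0 →
        maximalIdeal A • (⊤ : Submodule A E) = a • (⊤ : Submodule A E)) ∧
      (∀ x : E, x ∉ maximalIdeal A • (⊤ : Submodule A E) →
        maximalIdeal A • (⊤ : Submodule A E) = maximalIdeal A • Submodule.span A {x}) := by
  obtain ⟨hd, hm⟩ := isOAFRing_iff_of_isLocalRing.1 h
  have hnil : IsNilpotent (maximalIdeal (TrivSqZeroExt A E)) := by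
    refine hm.resolve_right fun ⟨_, _⟩ => ?_
    obtain ⟨e, he⟩ := exists_ne (0 : E)
    have := mul_self_eq_zero.1 (inr_mul_inr A e e)
    exact he (congrArg snd this)
  have hsq : ∀ x : TrivSqZeroExt A E, x ∉ maximalIdeal (TrivSqZeroExt A E) ^ 2 →
      maximalIdeal (TrivSqZeroExt A E) ^ 2 ≤ Ideal.span {x} := fun x hx =>
    (hd _).resolve_right fun hle => hx (hle (Ideal.mem_span_singleton_self x))
  have hM2 : maximalIdeal A ^ 2 = ⊥ := by
    obtain ⟨e, -, he⟩ := SetLike.exists_of_lt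
      (lt_top_iff_ne_top.2 (smul_top_ne_top_of_isNilpotent hnil))
    rw [eq_bot_iff]
    intro z hz
    obtain ⟨c, hc⟩ := Ideal.mem_span_singleton'.1
      (hsq (inr e) (fun hmem => he (mem_maximalIdeal_sq.1 hmem).2)
        (mem_maximalIdeal_sq (x := inl z) |>.2 ⟨hz, Submodule.zero_mem _⟩))
    have := congrArg fst hc
    simpa using this.symm
  refine ⟨hM2, fun a ha ha0 => le_antisymm (fun y hy => ?_) ?_, fun x hx =>
    le_antisymm (fun y hy => ?_) (Submodule.smul_mono le_rfl le_top)⟩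
  · have hne : (inl a : TrivSqZeroExt A E) ∉ maximalIdeal (TrivSqZeroExt A E) ^ 2 := fun hmem => by
      have := (mem_maximalIdeal_sq.1 hmem).1
      rw [hM2] at this
      exact ha0 this
    obtain ⟨c, hc⟩ := Ideal.mem_span_singleton'.1
      (hsq _ hne (mem_maximalIdeal_sq (x := inr y) |>.2 ⟨Submodule.zero_mem _, hy⟩))
    refine (Submodule.mem_smul_pointwise_iff_exists _ _ _).2 ⟨c.snd, trivial, ?_⟩
    simpa using congrArg snd hc
  · intro y hy
    obtain ⟨z, -, rfl⟩ := (Submodule.mem_smul_pointwise_iff_exists _ _ _).1 hy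
    exact Submodule.smul_mem_smul ha trivial
  · obtain ⟨c, hc⟩ := Ideal.mem_span_singleton'.1
      (hsq (inr x) (fun hmem => hx (mem_maximalIdeal_sq.1 hmem).2)
        (mem_maximalIdeal_sq (x := inr y) |>.2 ⟨Submodule.zero_mem _, hy⟩))
    have hcy : c.fst • x = y := by simpa using congrArg snd hc
    refine Submodule.mem_smul_span_singleton.2 ⟨c.fst, ?_, hcy⟩
    -- A unit coefficient would give `x ∈ 𝔪E`.
    by_contra hu
    obtain ⟨u, hu⟩ := notMem_maximalIdeal.1 hu
    refine hx ?_
    have : x = (↑u⁻¹ : A) • y := by rw [← hcy, ← hu, smul_smul, Units.inv_mul, one_smul]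
    rw [this]
    exact Submodule.smul_mem _ _ hy

theorem isOAFRing_of_conditions (hM2 : maximalIdeal A ^ 2 = ⊥)
    (ha : ∀ a ∈ maximalIdeal A, a ≠ 0 →
        maximalIdeal A • (⊤ : Submodule A E) = a • (⊤ : Submodule A E))
    (hx : ∀ x : E, x ∉ maximalIdeal A • (⊤ : Submodule A E) →
        maximalIdeal A • (⊤ : Submodule A E) = maximalIdeal A • Submodule.span A {x}) :
    IsOAFRing (TrivSqZeroExt A E) := by
  refine isOAFRing_iff_of_isLocalRing.2 ⟨fun J => ?_, Or.inl ⟨4, ?_⟩⟩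
  · by_cases hJ : J ≤ maximalIdeal (TrivSqZeroExt A E) ^ 2
    · exact Or.inr hJ
    obtain ⟨x, hxJ, hx2⟩ := Set.not_subset.1 hJ
    left
    by_cases hxm : x ∈ maximalIdeal (TrivSqZeroExt A E)
    · rw [maximalIdeal_eq] at hxm
      intro n hn
      obtain ⟨hn1, hn2⟩ := mem_maximalIdeal_sq.1 hn
      rw [hM2] at hn1
      have hn1 : n.fst = 0 := hn1
      -- If the first coordinate is 0, `inl` multiples of `x` cover `0 ∝ 𝔪E`; otherwise `inr`
      -- multiples do.
      by_cases hx0 : x.fst = 0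
      · have hxs : x.snd ∉ maximalIdeal A • (⊤ : Submodule A E) := fun hmem =>
          hx2 (mem_maximalIdeal_sq.2 ⟨hx0 ▸ Submodule.zero_mem _, hmem⟩)
        rw [hx _ hxs] at hn2
        obtain ⟨b, -, hb⟩ := Submodule.mem_smul_span_singleton.1 hn2
        convert J.mul_mem_left (inl b) hxJ using 1
        ext
        · simp [hn1, hx0]
        · simp [hb]
      · rw [ha _ hxm.1 hx0] at hn2
        obtain ⟨f, -, hf⟩ := (Submodule.mem_smul_pointwise_iff_exists _ _ _).1 hn2
        convert J.mul_mem_left (inr f) hxJ using 1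
        ext
        · simp [hn1]
        · simp [hf]
    · rw [J.eq_top_of_isUnit_mem hxJ (notMem_maximalIdeal.1 hxm)]
      exact le_top
  · rw [show 4 = 2 * 2 from rfl, pow_mul, Ideal.zero_eq_bot, eq_bot_iff, pow_two (_ ^ 2),
      Ideal.mul_le]
    intro x hx y hy
    obtain ⟨hx1, -⟩ := mem_maximalIdeal_sq.1 hx
    obtain ⟨hy1, -⟩ := mem_maximalIdeal_sq.1 hy
    rw [hM2] at hx1 hy1
    have hx1 : x.fst = 0 := hx1
    have hy1 : y.fst = 0 := hy1
    change x * y = 0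
    ext
    · simp [hx1]
    · simp [hx1, hy1]

end Local

end TrivSqZeroExt

/-! ### Rings in which every proper ideal is an OA-ideal -/

/-- Every proper ideal is an OA-ideal exactly in local rings whose maximal ideal squares to zero. -/
theorem forall_isOAIdeal_iff {R : Type*} [CommRing R] [Nontrivial R] :
    (∀ I : Ideal R, I ≠ ⊤ → IsOAIdeal I) ↔
      ∃ _ : IsLocalRing R, IsLocalRing.maximalIdeal R ^ 2 = ⊥ := by
  refine ⟨fun h => ?_, fun ⟨_, hm⟩ I hI => isOAIdeal_of_sq_le hI (hm.le.trans bot_le)⟩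
  have hloc : IsLocalRing R := by
    by_contra hloc
    have hp : ∀ I : Ideal R, I ≠ ⊤ → I.IsPrime := fun I hI =>
      (h I hI).isPrime_or_isLocalRing.resolve_right hloc
    have := IsDomain.of_bot_isPrime R (hbp := hp ⊥ bot_ne_top)
    -- Primality of `(x²)` gives `x ∈ (x²)`, so the domain is a field, hence local after all.
    have hzero : ∀ x ∈ nonunits R, x = 0 := fun x hx => by
      have hxx : x * x ∈ Ideal.span {x * x} := Ideal.mem_span_singleton_self _
      have hprime := hp (Ideal.span {x * x})
        (by rw [Ne, Ideal.span_singleton_eq_top]; exact fun hu => hx (isUnit_of_mul_isUnit_left hu))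
      obtain ⟨c, hc⟩ := Ideal.mem_span_singleton'.1 ((hprime.mem_or_mem hxx).elim id id)
      by_contra hx0
      refine hx (IsUnit.of_mul_eq_one c (mul_right_cancel₀ hx0 ?_))
      linear_combination hc
    refine hloc (IsLocalRing.of_nonunits_add fun a b ha hb => ?_)
    rw [hzero a ha, hzero b hb, add_zero]
    exact not_isUnit_zero
  refine ⟨hloc, ?_⟩
  rcases (h ⊥ bot_ne_top).isPrime_or_sq_le with hp | hle
  · have := IsDomain.of_bot_isPrime R (hbp := hp)
    have hzero : ∀ x ∈ IsLocalRing.maximalIdeal R, x = 0 := fun x hx => by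
      -- The cube serves both alternatives: `(x³)` prime gives `x ∈ (x³)`, and `𝔪² ≤ (x³)` gives `x²
      -- ∈ (x³)`.
      have hprod : x * x * x ∈ Ideal.span {x * x * x} := Ideal.mem_span_singleton_self _
      rcases (h (Ideal.span {x * x * x}) (by
        rw [Ne, Ideal.span_singleton_eq_top]
        exact fun hu => hx (isUnit_of_mul_isUnit_right hu))).isPrime_or_sq_le with hprime | hle
      · have hmem : x ∈ Ideal.span {x * x * x} :=
          (hprime.mem_or_mem hprod).elim (fun h => (hprime.mem_or_mem h).elim id id) id
        obtain ⟨c, hc⟩ := Ideal.mem_span_singleton'.1 hmem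
        exact eq_zero_of_mem_maximalIdeal_of_mul_eq (Ideal.mul_mem_left _ (c * x) hx)
          (by linear_combination -hc)
      · obtain ⟨c, hc⟩ := Ideal.mem_span_singleton'.1 (hle (Ideal.pow_mem_pow hx 2))
        exact pow_eq_zero_iff two_ne_zero |>.1
          (eq_zero_of_mem_maximalIdeal_of_mul_eq (Ideal.mul_mem_left _ c hx)
            (by linear_combination -hc))
    rw [eq_bot_iff, pow_two, Ideal.mul_le]
    intro x hx y _
    rw [hzero x hx, zero_mul]
    exact Submodule.zero_mem _
  · exact eq_bot_iff.2 hle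

/-! ### Idempotent maximal ideals of general ZPI-rings -/

section GeneralZPI

variable {R : Type*} [CommRing R]

theorem isProductOf_isPrime_of_isPrime_or_eq_top {I : Ideal R}
    (h : IsProductOf (fun J => J.IsPrime ∨ J = ⊤) I) : IsProductOf Ideal.IsPrime I := by
  obtain ⟨s, hs, rfl⟩ := h
  induction s using Multiset.induction_on with
  | empty => exact ⟨0, by simp, rfl⟩
  | cons J s ih =>
    rw [Multiset.prod_cons]
    have hs' := ih fun K hK => hs K (Multiset.mem_cons_of_mem hK)
    rcases hs J (Multiset.mem_cons_self J s) with hJ | rfl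
    · exact (IsProductOf.of_self hJ).mul hs'
    · rwa [Ideal.top_mul]

theorem IsGeneralZPIRing.of_isLocalization (h : IsGeneralZPIRing R) (M : Submonoid R)
    (S : Type*) [CommRing S] [Algebra R S] [IsLocalization M S] : IsGeneralZPIRing S := by
  intro I hI
  have hmap : (I.comap (algebraMap R S)).map (algebraMap R S) = I := IsLocalization.map_under M S I
  rw [← hmap]
  refine isProductOf_isPrime_of_isPrime_or_eq_top
    ((h _ (Ideal.comap_ne_top _ hI)).map _ fun J hJ _ => ?_)
  by_cases hd : Disjoint (M : Set R) (J : Set R)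
  · exact Or.inl (IsLocalization.isPrime_of_isPrime_disjoint M S J hJ hd)
  · right
    obtain ⟨x, hxM, hxJ⟩ := Set.not_disjoint_iff.1 hd
    exact Ideal.eq_top_of_isUnit_mem _ (Ideal.mem_map_of_mem _ hxJ)
      (IsLocalization.map_units S (⟨x, hxM⟩ : M))

/-- An idempotent maximal ideal of a general ZPI-ring is a minimal prime ideal. -/
theorem IsGeneralZPIRing.eq_of_isPrime_of_le (h : IsGeneralZPIRing R) {P Q : Ideal R}
    (hP : P.IsMaximal) (hPP : P * P = P) (hQ : Q.IsPrime) (hle : Q ≤ P) : Q = P := by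
  -- The localization at `P` is a field, so each element of `P` is killed by something outside `P`,
  -- hence outside `Q`.
  have hbot := (h.of_isLocalization P.primeCompl (Localization.AtPrime P)).maximalIdeal_eq_bot (by
    rw [← Localization.AtPrime.map_eq_maximalIdeal, ← Ideal.map_pow, pow_two, hPP])
  refine le_antisymm hle fun x hx => ?_
  have hx0 : algebraMap R (Localization.AtPrime P) x = 0 := by
    have hmem := Ideal.mem_map_of_mem (algebraMap R (Localization.AtPrime P)) hx
    rw [Localization.AtPrime.map_eq_maximalIdeal, hbot] at hmem
    exact hmem
  obtain ⟨m, hm⟩ := (IsLocalization.map_eq_zero_iff P.primeCompl _ x).1 hx0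
  exact (hQ.mem_or_mem (hm ▸ Q.zero_mem)).resolve_left fun hmQ => m.2 (hle hmQ)

theorem IsGeneralZPIRing.mem_of_prod_eq_bot (h : IsGeneralZPIRing R) {P : Ideal R}
    (hP : P.IsMaximal) (hPP : P * P = P) {s : Multiset (Ideal R)} (hs : ∀ Q ∈ s, Q.IsPrime)
    (hs0 : s.prod = ⊥) : P ∈ s := by
  obtain ⟨Q, hQ, hQP⟩ := hP.isPrime.multiset_prod_le.1 (hs0.le.trans bot_le)
  rwa [← h.eq_of_isPrime_of_le hP hPP (hs Q hQ) hQP]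

theorem Ideal.IsMaximal.exists_mul_add_eq_one {P : Ideal R} (hP : P.IsMaximal) {a : R}
    (ha : a ∉ P) : ∃ u, ∃ i ∈ P, u * a + i = 1 :=
  hP.exists_inv ha

/-- Write `0 = Pᵏ·B` with `B` the product of the prime factors other than `P`. Minimality gives `q ∈
B \ P`, and `Pq = 0` since `P` is idempotent. If `uq + f = 1` with `f ∈ P`, then `f` acts as the
identity on `P`. -/
theorem IsGeneralZPIRing.exists_idempotent_generator (h : IsGeneralZPIRing R) {P : Ideal R}
    (hP : P.IsMaximal) (hPP : P * P = P) : ∃ f, f * f = f ∧ P = Ideal.span {f} := by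
  classical
  have : Nontrivial R := ⟨0, 1, fun h01 => hP.ne_top ((Ideal.eq_top_iff_one _).2
    (h01 ▸ P.zero_mem))⟩
  obtain ⟨s, hs, hs0⟩ := h ⊥ bot_ne_top
  have hsplit : P ^ Multiset.card (s.filter (· = P)) * (s.filter (¬ · = P)).prod = ⊥ := by
    rw [← hs0, ← Multiset.prod_replicate, ← Multiset.eq_replicate_card.2
      (fun Q hQ => (Multiset.mem_filter.1 hQ).2), ← Multiset.prod_add, Multiset.filter_add_not]
  have hnle : ¬ (s.filter (¬ · = P)).prod ≤ P := fun hle => by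
    obtain ⟨Q, hQ, hQP⟩ := hP.isPrime.multiset_prod_le.1 hle
    obtain ⟨hQs, hQne⟩ := Multiset.mem_filter.1 hQ
    exact hQne (h.eq_of_isPrime_of_le hP hPP (hs Q hQs) hQP)
  obtain ⟨q, hq, hqP⟩ := Set.not_subset.1 hnle
  obtain ⟨u, f, hf, huf⟩ := hP.exists_mul_add_eq_one hqP
  have key : ∀ x ∈ P, x * f = x := fun x hx => by
    have hxq : x * q ∈ (⊥ : Ideal R) := by
      rw [← hsplit]
      exact Ideal.mul_mem_mul (Ideal.le_pow_of_mul_self_eq hPP _ hx) hq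
    have hxq : x * q = 0 := hxq
    linear_combination x * huf - u * hxq
  refine ⟨f, key f hf, le_antisymm (fun x hx => ?_) ((Ideal.span_singleton_le_iff_mem _).2 hf)⟩
  exact Ideal.mem_span_singleton'.2 ⟨x, key x hx⟩

theorem Ideal.eq_sup_span_mul_sup_span {K : Ideal R} {u v : R} (huv : u + v = 1)
    (huv0 : u * v = 0) : K = (K ⊔ Ideal.span {u}) * (K ⊔ Ideal.span {v}) := by
  apply le_antisymm
  · intro x hx
    have hx' : x = u * x + x * v := by linear_combination -x * huv
    rw [hx']
    exact Ideal.add_mem _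
      (Ideal.mul_mem_mul (Ideal.mem_sup_right (Ideal.mem_span_singleton_self u))
        (Ideal.mem_sup_left hx))
      (Ideal.mul_mem_mul (Ideal.mem_sup_left hx)
        (Ideal.mem_sup_right (Ideal.mem_span_singleton_self v)))
  · rw [Ideal.sup_mul, Ideal.mul_sup (Ideal.span {u}), Ideal.span_singleton_mul_span_singleton,
      huv0]
    refine sup_le Ideal.mul_le_left (sup_le Ideal.mul_le_right ?_)
    simp

end GeneralZPI

/-! ### From a general ZPI trivial extension to condition (A) -/

namespace TrivSqZeroExt

variable {A E : Type*} [CommRing A] [AddCommGroup E] [Module A E] [Module Aᵐᵒᵖ E]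
  [IsCentralScalar A E]

theorem exists_prod_eq_homogeneousIdeal (s : Multiset (Ideal (TrivSqZeroExt A E)))
    (hs : ∀ Q ∈ s, Q.IsPrime) (hs0 : s ≠ 0) :
    ∃ (C B : Ideal A) (h : C • (⊤ : Submodule A E) ≤ B • ⊤),
      s.prod = homogeneousIdeal C (B • ⊤) h := by
  induction s using Multiset.induction_on with
  | empty => exact absurd rfl hs0
  | cons Q s ih =>
    have hQ := eq_homogeneousIdeal_comap (inr_mem_of_isPrime (hs Q (Multiset.mem_cons_self Q s)))
    set q := Q.comap (inlHom A E)
    by_cases hs' : s = 0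
    · subst hs'
      refine ⟨q, ⊤, Submodule.smul_mono_left le_top, ?_⟩
      rw [Multiset.prod_cons, Multiset.prod_zero, mul_one, hQ]
      ext x
      simp
    · obtain ⟨C, B, h, hprod⟩ := ih (fun K hK => hs K (Multiset.mem_cons_of_mem hK)) hs'
      have heq : q • B • (⊤ : Submodule A E) ⊔ C • ⊤ = (q * B ⊔ C) • ⊤ := by
        rw [Submodule.sup_smul, Submodule.mul_smul]
      have hle : (q * C) • (⊤ : Submodule A E) ≤ q • B • (⊤ : Submodule A E) ⊔ C • ⊤ :=
        le_sup_of_le_right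
          (Submodule.smul_mono_left (Ideal.mul_le_right : q * C ≤ C))
      refine ⟨q * C, q * B ⊔ C, heq ▸ hle, ?_⟩
      rw [Multiset.prod_cons, hprod, hQ, homogeneousIdeal_mul le_top h hle]
      ext x
      rw [mem_homogeneousIdeal, mem_homogeneousIdeal, heq]

section OfGeneralZPI

variable (h : IsGeneralZPIRing (TrivSqZeroExt A E))
include h

/-- If `A ∝ E` is a general ZPI-ring then `E` is a multiplication module. -/
theorem exists_eq_smul_top [Nontrivial A] (F : Submodule A E) :
    ∃ B : Ideal A, F = B • (⊤ : Submodule A E) := by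
  have hF : (⊥ : Ideal A) • (⊤ : Submodule A E) ≤ F := by simp
  have hne : homogeneousIdeal ⊥ F hF ≠ ⊤ := fun ht => by
    have h1 : (1 : TrivSqZeroExt A E) ∈ homogeneousIdeal ⊥ F hF := ht ▸ trivial
    exact one_ne_zero h1.1
  obtain ⟨s, hs, hsF⟩ := h _ hne
  obtain ⟨C, B, hCB, hprod⟩ := exists_prod_eq_homogeneousIdeal s hs fun hs0 => hne (by
    rw [← hsF, hs0, Multiset.prod_zero, Ideal.one_eq_top])
  refine ⟨B, ?_⟩
  ext e
  have := SetLike.ext_iff.1 (hsF.symm.trans hprod) (inr e)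
  simpa using this

/-- With `N = P ∝ E`, the ideal `K = P ∝ PE` lies between `N²` and `N`, so it is a power of `N`. As
`PE ≠ E`, it is not `N`; thus `K ≤ N² = P² ∝ PE`. -/
theorem mul_self_eq_of_smul_top_ne_top {P : Ideal A} (hP : P.IsMaximal)
    (hPE : P • (⊤ : Submodule A E) ≠ ⊤) : P * P = P := by
  set N : Ideal (TrivSqZeroExt A E) := homogeneousIdeal P ⊤ le_top with hN
  have hNmax : N.IsMaximal := by
    rw [hN, homogeneousIdeal_top_eq_comap]
    exact Ideal.comap_isMaximal_of_surjective _ fstRingHom_surjective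
  set K : Ideal (TrivSqZeroExt A E) := homogeneousIdeal P (P • ⊤) le_rfl with hK
  have hNK : N ^ 2 ≤ K := by
    rw [hN, homogeneousIdeal_top_sq]
    exact fun x hx => ⟨Ideal.pow_le_self two_ne_zero hx.1, hx.2⟩
  have hKN : K ≤ N := fun x hx => ⟨hx.1, trivial⟩
  obtain ⟨s, hs, hsK⟩ := h K fun ht => hNmax.ne_top (top_le_iff.1 (ht ▸ hKN))
  have hall : ∀ Q ∈ s, Q = N := fun Q hQ =>
    (hNmax.eq_of_le (hs Q hQ).ne_top fun x hx => (hs Q hQ).mem_of_pow_mem 2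
      (Ideal.multiset_prod_le_of_mem hQ (hsK ▸ hNK (Ideal.pow_mem_pow hx 2)))).symm
  rw [Multiset.eq_replicate_card.2 hall, Multiset.prod_replicate] at hsK
  have hle : K ≤ N ^ 2 := by
    rcases hc : Multiset.card s with _ | _ | n
    · rw [hc, pow_zero, Ideal.one_eq_top] at hsK
      exact absurd (top_le_iff.1 (hsK ▸ hKN)) hNmax.ne_top
    · rw [hc, zero_add, pow_one] at hsK
      refine absurd (eq_top_iff.2 fun e _ => ?_) hPE
      have hmem : (inr e : TrivSqZeroExt A E) ∈ N := ⟨P.zero_mem, trivial⟩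
      rw [hsK] at hmem
      exact hmem.2
    · rw [← hsK, hc]
      exact Ideal.pow_le_pow_right (by omega)
  refine le_antisymm Ideal.mul_le_left fun p hp => ?_
  have hmem : (inl p : TrivSqZeroExt A E) ∈ N ^ 2 := hle ⟨hp, Submodule.zero_mem _⟩
  rw [hN, homogeneousIdeal_top_sq] at hmem
  rw [← pow_two]
  exact hmem.1

/-- As `E` is a multiplication module, `Ae = BE = BPE = P·Ae`. -/
theorem exists_smul_eq_self [Nontrivial A] {P : Ideal A} (hPE : P • (⊤ : Submodule A E) = ⊤)
    (e : E) : ∃ p ∈ P, p • e = e := by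
  obtain ⟨B, hB⟩ := exists_eq_smul_top h (Submodule.span A {e})
  refine Submodule.mem_smul_span_singleton.1 ?_
  rw [hB, ← Submodule.mul_smul, mul_comm, Submodule.mul_smul, hPE, ← hB]
  exact Submodule.mem_span_singleton_self e

theorem exists_local_generator [Nontrivial A] (hA : IsGeneralZPIRing A) {P : Ideal A}
    (hP : P.IsMaximal) (hPE : P • (⊤ : Submodule A E) ≠ ⊤) :
    ∃ (f : A) (e : E), f * f = f ∧ P = Ideal.span {f} ∧ e ∉ P • (⊤ : Submodule A E) ∧
      ∀ y : E, ∃ a : A, (1 - f) • y = a • (1 - f) • e := by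
  obtain ⟨f, hf, hPf⟩ :=
    hA.exists_idempotent_generator hP (mul_self_eq_of_smul_top_ne_top h hP hPE)
  obtain ⟨e, -, he⟩ := SetLike.exists_of_lt (lt_top_iff_ne_top.2 hPE)
  refine ⟨f, e, hf, hPf, he, fun y => ?_⟩
  obtain ⟨B, hB⟩ := exists_eq_smul_top h (Submodule.span A {e})
  -- With `Ae = BE` and `e ∉ PE`, some `b ∈ B \ P` maps `E` into `Ae`; this `b` is invertible modulo
  -- `P = (f)`, hence on the `1 - f` component.
  have hBP : ¬ B ≤ P := fun hle => he (Submodule.smul_mono_left hle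
    (hB ▸ Submodule.mem_span_singleton_self e))
  obtain ⟨b, hb, hbP⟩ := Set.not_subset.1 hBP
  have hby : b • y ∈ Submodule.span A {e} := hB ▸ Submodule.smul_mem_smul hb trivial
  obtain ⟨c, hc⟩ := Submodule.mem_span_singleton.1 hby
  obtain ⟨u, i, hi, hui⟩ := hP.exists_mul_add_eq_one hbP
  rw [hPf] at hi
  obtain ⟨d, rfl⟩ := Ideal.mem_span_singleton'.1 hi
  refine ⟨u * c, ?_⟩
  have h1 : (1 - f) = (1 - f) * u * b := by
    linear_combination -(1 - f) * hui - d * hf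
  calc (1 - f) • y = ((1 - f) * u) • b • y := by rw [smul_smul, ← h1]
    _ = _ := by
      rw [← hc, smul_smul, smul_smul]
      congr 1
      ring

theorem isPrincipal_and_isProductOf [Nontrivial A] :
    (⊤ : Submodule A E).IsPrincipal ∧
      IsProductOf (fun P : Ideal A => P.IsMaximal ∧ P * P = P) (Module.annihilator A E) := by
  classical
  have hA : IsGeneralZPIRing A := h.of_surjective (fstRingHom A E) fstRingHom_surjective
  obtain ⟨s, hs, hs0⟩ := hA ⊥ bot_ne_top
  -- Finiteness: every maximal `P` with `PE ≠ E` occurs among the prime factors of 0.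
  set T : Finset (Ideal A) :=
    s.toFinset.filter fun P => P.IsMaximal ∧ P • (⊤ : Submodule A E) ≠ ⊤ with hT
  have hTmem : ∀ P : Ideal A, P ∈ T ↔ P.IsMaximal ∧ P • (⊤ : Submodule A E) ≠ ⊤ := fun P => by
    rw [hT, Finset.mem_filter, Multiset.mem_toFinset, and_iff_right_iff_imp]
    exact fun hP => hA.mem_of_prod_eq_bot hP.1 (mul_self_eq_of_smul_top_ne_top h hP.1 hP.2) hs hs0
  have hgen : ∀ P ∈ T, ∃ (f : A) (e : E), f * f = f ∧ P = Ideal.span {f} ∧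
      e ∉ P • (⊤ : Submodule A E) ∧ ∀ y : E, ∃ a : A, (1 - f) • y = a • (1 - f) • e :=
    fun P hP => exists_local_generator h hA ((hTmem P).1 hP).1 ((hTmem P).1 hP).2
  choose! f e hf hPf he hfe using hgen
  have hfP : ∀ P ∈ T, f P ∈ P := fun P hP => by
    have := Ideal.mem_span_singleton_self (f P)
    rwa [← hPf P hP] at this
  have horth : ∀ P ∈ T, ∀ Q ∈ T, P ≠ Q → (1 - f P) * (1 - f Q) = 0 := by
    intro P hP Q hQ hne
    have hPm := ((hTmem P).1 hP).1
    have hQm := ((hTmem Q).1 hQ).1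
    have hfPQ : f P ∉ Q := fun hmem => hne (hPm.eq_of_le hQm.ne_top (by
      rw [hPf P hP]
      exact (Ideal.span_singleton_le_iff_mem _).2 hmem))
    have h0 : f P * (1 - f P) ∈ Q := by
      rw [mul_sub, mul_one, hf P hP, sub_self]
      exact Q.zero_mem
    have h1 := (hQm.isPrime.mem_or_mem h0).resolve_left hfPQ
    rw [hPf Q hQ] at h1
    obtain ⟨c, hc⟩ := Ideal.mem_span_singleton'.1 h1
    rw [← hc]
    linear_combination -c * hf Q hQ
  -- The conductor `(F : y)` lies in no maximal ideal: it contains `1 - f P` for `P ∈ T`, and `1 -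
  -- p` with `p ∈ P` fixing `y` when `PE = E`.
  have hmem_of_local : ∀ (F : Submodule A E) (y : E), (∀ P ∈ T, (1 - f P) • y ∈ F) → y ∈ F := by
    intro F y hy
    by_contra hcon
    have hne : Submodule.colon F ({y} : Set E) ≠ ⊤ := fun ht => hcon (by
      have h1 : (1 : A) ∈ Submodule.colon F ({y} : Set E) := ht ▸ trivial
      simpa using Submodule.mem_colon_singleton.1 h1)
    obtain ⟨P, hP, hle⟩ := Ideal.exists_le_maximal _ hne
    refine hP.ne_top ((Ideal.eq_top_iff_one _).2 ?_)
    by_cases hPT : P ∈ T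
    · simpa using P.add_mem (hle (Submodule.mem_colon_singleton.2 (hy P hPT))) (hfP P hPT)
    · have hPE : P • (⊤ : Submodule A E) = ⊤ := by
        by_contra hPE
        exact hPT ((hTmem P).2 ⟨hP, hPE⟩)
      obtain ⟨p, hp, hpy⟩ := exists_smul_eq_self h hPE y
      have h1 : 1 - p ∈ Submodule.colon F ({y} : Set E) := by
        rw [Submodule.mem_colon_singleton, sub_smul, one_smul, hpy, sub_self]
        exact F.zero_mem
      simpa using P.add_mem (hle h1) hp
  constructor
  · set x : E := ∑ P ∈ T, (1 - f P) • e P with hx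
    have hxP : ∀ P ∈ T, (1 - f P) • x = (1 - f P) • e P := by
      intro P hP
      rw [hx, Finset.smul_sum, Finset.sum_eq_single_of_mem P hP, smul_smul]
      · congr 1
        linear_combination hf P hP
      · intro Q hQ hne
        rw [smul_smul, horth P hP Q hQ hne.symm, zero_smul]
    refine ⟨x, (eq_top_iff.2 fun y _ => hmem_of_local _ y fun P hP => ?_).symm⟩
    obtain ⟨a, ha⟩ := hfe P hP y
    rw [ha, ← hxP P hP, smul_smul]
    exact Submodule.smul_mem _ _ (Submodule.mem_span_singleton_self x)
  · refine ⟨T.val, fun P hP => ?_, ?_⟩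
    · obtain ⟨hPm, hPE⟩ := (hTmem P).1 hP
      exact ⟨hPm, mul_self_eq_of_smul_top_ne_top h hPm hPE⟩
    apply le_antisymm
    · intro a ha
      rw [Module.mem_annihilator]
      intro y
      refine (Submodule.mem_bot A).1 (hmem_of_local ⊥ (a • y) fun P hP => ?_)
      have haP : a ∈ P := Ideal.multiset_prod_le_of_mem hP ha
      rw [hPf P hP] at haP
      obtain ⟨c, rfl⟩ := Ideal.mem_span_singleton'.1 haP
      have h0 : (1 - f P) * (c * f P) = 0 := by linear_combination -c * hf P hP
      rw [smul_smul, h0, zero_smul]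
      exact Submodule.zero_mem _
    · intro a ha
      -- If `a ∉ P`, then `a` is invertible modulo `P` and kills `e P`, which puts `e P` in `PE`.
      have haP : ∀ P ∈ T, a ∈ P := by
        intro P hP
        by_contra hcon
        obtain ⟨u, i, hi, hui⟩ := ((hTmem P).1 hP).1.exists_mul_add_eq_one hcon
        refine he P hP ?_
        have : e P = i • e P := by
          have h1 : (u * a + i) • e P = e P := by rw [hui, one_smul]
          rwa [add_smul, mul_smul, Module.mem_annihilator.1 ha, smul_zero, zero_add, eq_comm]
            at h1
        rw [this]
        exact Submodule.smul_mem_smul hi trivial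
      have key : ∀ U ⊆ T, a ∈ ∏ P ∈ U, P := by
        intro U
        induction U using Finset.induction_on with
        | empty => intro _; simp [Ideal.one_eq_top]
        | insert P U hPU ih =>
          intro hsub
          have hPT := hsub (Finset.mem_insert_self P U)
          rw [Finset.prod_insert hPU]
          have haf := haP P hPT
          rw [hPf P hPT] at haf
          obtain ⟨c, hc⟩ := Ideal.mem_span_singleton'.1 haf
          have : a = f P * a := by
            rw [← hc]
            linear_combination -c * hf P hPT
          rw [this]
          exact Ideal.mul_mem_mul (hfP P hPT)
            (ih ((Finset.subset_insert P U).trans hsub))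
      have hT' := key T subset_rfl
      rwa [Finset.prod_eq_multiset_prod, Multiset.map_id'] at hT'

end OfGeneralZPI

/-! ### From condition (A) to a general ZPI trivial extension -/

section ToGeneralZPI

/-- Multiplying by `inl g` fixes `0 ∝ E`, so any ideal containing `inl g` is pulled back from `A`.
The product of the pulled-back primes again contains the idempotent `inl g`, so it is determined by
its image. -/
theorem isProductOf_isPrime_of_idempotent_mem (hA : IsGeneralZPIRing A)
    {K : Ideal (TrivSqZeroExt A E)} {g : A} (hg : g * g = g) (hgE : ∀ e : E, g • e = e)
    (hgK : inl g ∈ K) : IsProductOf Ideal.IsPrime K := by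
  have hker : ∀ L : Ideal (TrivSqZeroExt A E), inl g ∈ L →
      RingHom.ker (fstRingHom A E) ≤ L := by
    intro L hL x hx
    have hx0 : x.fst = 0 := hx
    have : x = x * inl g := by
      ext
      · simp [hx0]
      · simp [hgE]
    rw [this]
    exact L.mul_mem_left _ hL
  have hcm : ∀ L : Ideal (TrivSqZeroExt A E), inl g ∈ L →
      (L.map (fstRingHom A E)).comap (fstRingHom A E) = L := fun L hL => by
    rw [Ideal.comap_map_of_surjective' (fstRingHom A E) fstRingHom_surjective, sup_eq_left.2 (hker L hL)]
  by_cases htop : K.map (fstRingHom A E) = ⊤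
  · rw [← hcm K hgK, htop, Ideal.comap_top]
    exact isProductOf_top _
  obtain ⟨s, hs, hsK⟩ := hA _ htop
  have hgs : g ∈ s.prod := hsK ▸ Ideal.mem_map_of_mem (fstRingHom A E) hgK
  refine ⟨s.map (Ideal.comap (fstRingHom A E)), fun J hJ => ?_, ?_⟩
  · obtain ⟨Q, hQ, rfl⟩ := Multiset.mem_map.1 hJ
    exact (hs Q hQ).comap _
  · have hmem : inl g ∈ (s.map (Ideal.comap (fstRingHom A E))).prod := by
      have hle := Ideal.pow_card_le_multiset_prod (s := s.map (Ideal.comap (fstRingHom A E)))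
        (J := Ideal.span {inl g}) fun J hJ => by
          obtain ⟨Q, hQ, rfl⟩ := Multiset.mem_map.1 hJ
          rw [Ideal.span_singleton_le_iff_mem]
          exact Ideal.multiset_prod_le_of_mem hQ hgs
      refine hle (Ideal.le_pow_of_mul_self_eq ?_ _ (Ideal.mem_span_singleton_self _))
      rw [Ideal.span_singleton_mul_span_singleton, ← inl_mul, hg]
    rw [← hcm _ hmem, Ideal.map_multiset_prod_eq, Multiset.map_map]
    have : s.map (Ideal.map (fstRingHom A E) ∘ Ideal.comap (fstRingHom A E)) = s := by
      conv_rhs => rw [← Multiset.map_id s]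
      exact Multiset.map_congr rfl fun Q _ =>
        Ideal.map_comap_of_surjective (fstRingHom A E) fstRingHom_surjective Q
    rw [this, hsK, hcm K hgK]

/-- Here `K` contains `P ∝ PE = N²`, where `N = P ∝ E`. Since `E/PE` is cyclic over the field `A/P`,
only the unit ideal, `N` and `N²` are possible. -/
theorem isProductOf_isPrime_of_map_inl_le {P : Ideal A} (hP : P.IsMaximal) (hPP : P * P = P)
    {x : E} (hx : ∀ e : E, ∃ a : A, a • x = e) {K : Ideal (TrivSqZeroExt A E)}
    (hPK : ∀ p ∈ P, inl p ∈ K) : IsProductOf Ideal.IsPrime K := by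
  by_cases hK : K = ⊤
  · rw [hK]
    exact isProductOf_top _
  set N : Ideal (TrivSqZeroExt A E) := homogeneousIdeal P ⊤ le_top with hN
  have hNp : N.IsPrime := by
    rw [hN, homogeneousIdeal_top_eq_comap]
    exact hP.isPrime.comap _
  have hKN : K ≤ N := by
    intro k hk
    refine ⟨?_, trivial⟩
    by_contra hkP
    obtain ⟨u, i, hi, hui⟩ := hP.exists_mul_add_eq_one hkP
    refine hK (K.eq_top_of_isUnit_mem (K.add_mem (K.mul_mem_left (inl u) hk) (hPK i hi)) ?_)
    rw [isUnit_iff_isUnit_fst]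
    simp [hui]
  by_cases hsnd : ∀ k ∈ K, k.snd ∈ P • (⊤ : Submodule A E)
  · have hKN2 : K = N ^ 2 := by
      rw [hN, homogeneousIdeal_top_sq]
      ext k
      rw [mem_homogeneousIdeal, pow_two, hPP]
      refine ⟨fun hk => ⟨(hKN hk).1, hsnd k hk⟩, fun hk =>
        mem_of_inl_mem_of_inr_mem (hPK _ hk.1) ?_⟩
      refine Submodule.smul_induction_on hk.2 (fun p hp e _ => ?_) fun a b ha hb => ?_
      · rw [← inl_mul_inr]
        exact K.mul_mem_right _ (hPK p hp)
      · rw [inr_add]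
        exact K.add_mem ha hb
    rw [hKN2]
    exact (IsProductOf.of_self hNp).pow 2
  · push Not at hsnd
    obtain ⟨k, hk, hkP⟩ := hsnd
    have hNK : N ≤ K := by
      intro n hn
      refine mem_of_inl_mem_of_inr_mem (hPK _ hn.1) ?_
      have hks : inr k.snd ∈ K := by
        rw [eq_sub_of_add_eq' (inl_fst_add_inr_snd_eq k)]
        exact K.sub_mem hk (hPK _ (hKN hk).1)
      obtain ⟨a, ha⟩ := hx k.snd
      obtain ⟨c, hc⟩ := hx n.snd
      have haP : a ∉ P := fun haP => hkP (ha ▸ Submodule.smul_mem_smul haP trivial)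
      obtain ⟨u, i, hi, hui⟩ := hP.exists_mul_add_eq_one haP
      have : (inr n.snd : TrivSqZeroExt A E) = inl (c * u) * inr k.snd + inl i * inr (c • x) := by
        rw [inl_mul_inr, inl_mul_inr, ← inr_add, ← hc, ← ha, smul_smul, smul_smul, ← add_smul]
        congr 2
        linear_combination -c * hui
      rw [this]
      exact K.add_mem (K.mul_mem_left _ hks) (K.mul_mem_right _ (hPK i hi))
    rw [le_antisymm hKN hNK]
    exact .of_self hNp

theorem exists_idempotent_generator_of_prod (hA : IsGeneralZPIRing A) (s : Multiset (Ideal A))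
    (hs : ∀ P ∈ s, P.IsMaximal ∧ P * P = P) : ∃ f, f * f = f ∧ s.prod = Ideal.span {f} := by
  induction s using Multiset.induction_on with
  | empty => exact ⟨1, one_mul 1, by simp [Ideal.one_eq_top]⟩
  | cons P s ih =>
    obtain ⟨f, hf, hsf⟩ := ih fun Q hQ => hs Q (Multiset.mem_cons_of_mem hQ)
    obtain ⟨hP, hPP⟩ := hs P (Multiset.mem_cons_self P s)
    obtain ⟨f', hf', hPf⟩ := hA.exists_idempotent_generator hP hPP
    refine ⟨f' * f, by rw [mul_mul_mul_comm, hf, hf'], ?_⟩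
    rw [Multiset.prod_cons, hsf, hPf, Ideal.span_singleton_mul_span_singleton]

/-- The idempotent generating one `P` splits `K` into a factor containing `inl P` and a factor
handled by the remaining maximal ideals. -/
theorem isProductOf_isPrime_of_prod_le (hA : IsGeneralZPIRing A) {x : E}
    (hx : ∀ e : E, ∃ a : A, a • x = e) (s : Multiset (Ideal A))
    (hs : ∀ P ∈ s, P.IsMaximal ∧ P * P = P) (K : Ideal (TrivSqZeroExt A E))
    (hK : ∀ p ∈ s.prod, inl p ∈ K) : IsProductOf Ideal.IsPrime K := by
  induction s using Multiset.induction_on generalizing K with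
  | empty =>
    rw [K.eq_top_of_isUnit_mem (hK 1 (by simp [Ideal.one_eq_top])) (by simp)]
    exact isProductOf_top _
  | cons P s ih =>
    obtain ⟨hP, hPP⟩ := hs P (Multiset.mem_cons_self P s)
    obtain ⟨f, hf, hPf⟩ := hA.exists_idempotent_generator hP hPP
    rw [Ideal.eq_sup_span_mul_sup_span (K := K) (u := inl f) (v := inl (1 - f))
      (by rw [← inl_add]; simp) (by
        rw [← inl_mul, mul_sub, mul_one, hf, sub_self, inl_zero])]
    refine (isProductOf_isPrime_of_map_inl_le hP hPP hx fun p hp => ?_).mul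
      (ih (fun Q hQ => hs Q (Multiset.mem_cons_of_mem hQ)) _ fun p hp => ?_)
    · rw [hPf] at hp
      obtain ⟨c, rfl⟩ := Ideal.mem_span_singleton'.1 hp
      rw [inl_mul]
      exact Ideal.mul_mem_left _ _ (Ideal.mem_sup_right (Ideal.mem_span_singleton_self _))
    · have hfp : f * p ∈ (P ::ₘ s).prod := by
        rw [Multiset.prod_cons, hPf]
        exact Ideal.mul_mem_mul (Ideal.mem_span_singleton_self f) hp
      have hsplit : (inl p : TrivSqZeroExt A E) = inl (f * p) + inl p * inl (1 - f) := by
        rw [← inl_mul, ← inl_add]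
        congr 1
        ring
      rw [hsplit]
      exact Ideal.add_mem _ (Ideal.mem_sup_left (hK _ hfp))
        (Ideal.mul_mem_left _ _ (Ideal.mem_sup_right (Ideal.mem_span_singleton_self _)))

theorem isGeneralZPIRing_of_isPrincipal (hA : IsGeneralZPIRing A)
    (hE : (⊤ : Submodule A E).IsPrincipal)
    (hann : IsProductOf (fun P : Ideal A => P.IsMaximal ∧ P * P = P) (Module.annihilator A E)) :
    IsGeneralZPIRing (TrivSqZeroExt A E) := by
  intro K _
  obtain ⟨x, hx⟩ := hE
  have hx' : ∀ e : E, ∃ a : A, a • x = e := fun e =>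
    Submodule.mem_span_singleton.1 (hx ▸ trivial)
  obtain ⟨s, hs, hsE⟩ := hann
  obtain ⟨f, hf, hsf⟩ := exists_idempotent_generator_of_prod hA s hs
  have hfE : ∀ e : E, f • e = 0 := Module.mem_annihilator.1
    (hsE ▸ hsf ▸ Ideal.mem_span_singleton_self f)
  -- The first factor contains the image of the annihilator `(f)`; the second contains `inl (1 -
  -- f)`, and `1 - f` is the identity on `E`.
  rw [Ideal.eq_sup_span_mul_sup_span (K := K) (u := inl f) (v := inl (1 - f))
    (by rw [← inl_add]; simp) (by rw [← inl_mul, mul_sub, mul_one, hf, sub_self, inl_zero])]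
  refine (isProductOf_isPrime_of_prod_le hA hx' s hs _ fun p hp => ?_).mul
    (isProductOf_isPrime_of_idempotent_mem hA (g := 1 - f) ?_ (fun e => ?_)
      (Ideal.mem_sup_right (Ideal.mem_span_singleton_self _)))
  · rw [hsf] at hp
    obtain ⟨c, rfl⟩ := Ideal.mem_span_singleton'.1 hp
    rw [inl_mul]
    exact Ideal.mul_mem_left _ _ (Ideal.mem_sup_right (Ideal.mem_span_singleton_self _))
  · linear_combination hf
  · rw [sub_smul, one_smul, hfE, sub_zero]

end ToGeneralZPI

end TrivSqZeroExt

/-! ### Assembly of the cases -/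

theorem theorem5 {A : Type*} {E : Type*} [CommRing A] [Nontrivial A] [AddCommGroup E] [Module A E]
    [Module Aᵐᵒᵖ E] [IsCentralScalar A E]
    (M : Ideal A) (hM : M = Ideal.jacobson (⊥ : Ideal A)) :
    (IsOAFRing (TrivSqZeroExt A E) ↔
      (IsGeneralZPIRing A ∧ (⊤ : Submodule A E).IsPrincipal ∧
        IsProductOf (fun P : Ideal A => P.IsMaximal ∧ P * P = P) (Module.annihilator A E)) ∨
      (IsLocalRing A ∧ IsDividedIdeal (M ^ 2) ∧ Subsingleton E ∧
        (IsNilpotent M ∨ (IsDomain A ∧ (⨅ n : ℕ, M ^ n) = (⊥ : Ideal A)))) ∨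
      (IsLocalRing A ∧ M ^ 2 = ⊥ ∧
        (∀ a ∈ M, a ≠ 0 → M • (⊤ : Submodule A E) = a • (⊤ : Submodule A E)) ∧
        (∀ x : E, x ∉ M • (⊤ : Submodule A E) →
          M • (⊤ : Submodule A E) = M • Submodule.span A {x}))) ∧
    (IsOAFRing (TrivSqZeroExt A E) → IsOAFRing A) ∧
    ((∀ I : Ideal (TrivSqZeroExt A E), I ≠ ⊤ → IsOAIdeal I) ↔
      IsLocalRing A ∧ M ^ 2 = ⊥ ∧ M • (⊤ : Submodule A E) = ⊥) := by
  have hloc : ∀ [IsLocalRing A], M = IsLocalRing.maximalIdeal A := fun {_} =>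
    hM.trans (IsLocalRing.jacobson_eq_maximalIdeal ⊥ bot_ne_top)
  have hfst : IsOAFRing (TrivSqZeroExt A E) → IsOAFRing A := fun h =>
    h.of_surjective (TrivSqZeroExt.fstRingHom A E) TrivSqZeroExt.fstRingHom_surjective
  refine ⟨⟨fun h => ?_, ?_⟩, hfst, ?_⟩
  · by_cases hA : IsLocalRing A
    · right
      rw [hloc]
      have := TrivSqZeroExt.isLocalRing_iff (A := A) (E := E) |>.2 hA
      rcases subsingleton_or_nontrivial E with hE | hE
      · obtain ⟨hd, hm⟩ := isOAFRing_iff_of_isLocalRing.1 (hfst h)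
        exact Or.inl ⟨hA, hd, hE, hm⟩
      · exact Or.inr ⟨hA, TrivSqZeroExt.conditions_of_isOAFRing h⟩
    · left
      have hR := h.isGeneralZPIRing_of_not_isLocalRing
        (mt TrivSqZeroExt.isLocalRing_iff.1 hA)
      exact ⟨hR.of_surjective (TrivSqZeroExt.fstRingHom A E) TrivSqZeroExt.fstRingHom_surjective,
        TrivSqZeroExt.isPrincipal_and_isProductOf hR⟩
  · rintro (⟨hA, hE, hann⟩ | ⟨hA, hd, hE, hm⟩ | ⟨hA, hM2, ha, hx⟩)
    · exact (TrivSqZeroExt.isGeneralZPIRing_of_isPrincipal hA hE hann).isOAFRing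
    · rw [hloc] at hd hm
      exact (isOAFRing_iff_of_isLocalRing.2 ⟨hd, hm⟩).of_surjective (TrivSqZeroExt.inlHom A E)
        TrivSqZeroExt.inlHom_surjective
    · have := TrivSqZeroExt.isLocalRing_iff (A := A) (E := E) |>.2 hA
      rw [hloc] at hM2 ha hx
      exact TrivSqZeroExt.isOAFRing_of_conditions hM2 ha hx
  · rw [forall_isOAIdeal_iff]
    constructor
    · rintro ⟨hR, hm⟩
      have hA := TrivSqZeroExt.isLocalRing_iff.1 hR
      rw [hloc]
      exact ⟨hA, TrivSqZeroExt.maximalIdeal_sq_eq_bot_iff.1 hm⟩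
    · rintro ⟨hA, hm⟩
      have hR := TrivSqZeroExt.isLocalRing_iff (A := A) (E := E) |>.2 hA
      rw [hloc] at hm
      exact ⟨hR, TrivSqZeroExt.maximalIdeal_sq_eq_bot_iff.2 hm⟩
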